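/- Let $\psi_1,\psi_2,\psi_3>0$, $F_1>0$, $\tau\in\mathbb R$, $\mu_{1,1},\mu_{2,1}\in\mathbb R$ and $\mu_{1,2},\mu_{2,2}>0$. (In the double random feature model with nonlinear activations $\sigma_1,\sigma_2$ and ridge parameter $\lambda$, these are $\psi_j=\lim N_j/d$ for $j=1,2$, $\psi_3=\lim n/d$, the limiting signal norm $F_1$, the noise level $\tau$, and the spherical moments $\mu_{j,1}=\mathbb E[G\sigma_j(G)]$, $\mu_{j,2}^2=\mathbb E[\sigma_j(G)^2]-\mathbb E[\sigma_j(G)]^2-\mu_{j,1}^2$ with $G\sim N(0,1)$; $\mu_{j,2}>0$ says that $\sigma_j$ is not almost everywhere equal to an affine function.) Let $\nu=(\nu_1,\nu_2,\nu_3):\mathbb C_+\to\mathbb C_+^3$ be the unique analytic function on the open upper half plane that satisfies, for every $\xi\in\mathbb C_+$, with $D=1-\mu_{1,1}^2\nu_1\nu_3-\mu_{2,1}^2\nu_2\nu_3$, $$\nu_1\Big(-\xi-\mu_{1,2}^2\nu_3-\frac{\mu_{1,1}^2\nu_3}{D}\Big)=\psi_1,\qquad \nu_2\Big(-\xi-\mu_{2,2}^2\nu_3-\frac{\mu_{2,1}^2\nu_3}{D}\Big)=\psi_2,$$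 $$\nu_3\Big(-\xi-\mu_{1,2}^2\nu_1-\mu_{2,2}^2\nu_2-\frac{\mu_{1,1}^2\nu_1+\mu_{2,1}^2\nu_2}{D}\Big)=\psi_3,$$ and for which there is $\xi_0>0$ with $|\nu_j(\xi)|\le 2\psi_j/\xi_0$ for $j=1,2,3$ whenever $\operatorname{Im}\xi\ge\xi_0$. For $\lambda>0$ put $\nu_j^*=\nu_j(\sqrt\lambda\, i)$, $M_N=\nu_1^*\mu_{1,1}^2+\nu_2^*\mu_{2,1}^2$, $M_D=\nu_3^*M_N-1$, let $H$ be the symmetric matrix $$H=\begin{bmatrix}-\frac{\nu_3^{*2}\mu_{1,1}^4}{M_D^2}+\frac{\psi_1}{\nu_1^{*2}}&-\frac{\nu_3^{*2}\mu_{1,1}^2\mu_{2,1}^2}{M_D^2}&-\frac{\mu_{1,1}^2}{M_D^2}-\mu_{1,2}^2\\ *&-\frac{\nu_3^{*2}\mu_{2,1}^4}{M_D^2}+\frac{\psi_2}{\nu_2^{*2}}&-\frac{\mu_{2,1}^2}{M_D^2}-\mu_{2,2}^2\\ *&*&-\frac{M_N^2}{M_D^2}+\frac{\psi_3}{\nu_3^{*2}}\end{bmatrix},$$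 let $$V=\begin{bmatrix}\mu_{1,2}^2&0&\frac{\mu_{1,1}^2}{M_D^2}&\frac{\nu_3^{*2}\mu_{1,1}^2}{M_D^2}\\ \mu_{2,2}^2&0&\frac{\mu_{2,1}^2}{M_D^2}&\frac{\nu_3^{*2}\mu_{2,1}^2}{M_D^2}\\ 0&1&\frac{M_N^2}{M_D^2}&\frac{1}{M_D^2}\end{bmatrix},$$ put $L=V^{\mathsf T}H^{-1}V$, and let the asymptotic excess risk be the (real) number $$\mathcal R=F_1^2\Big(\frac1{M_D^2}+L_{3,4}+L_{1,4}\Big)+\tau^2\big(L_{2,3}+L_{1,2}\big).$$ Then: 1. If $(\psi_1+\psi_2)/\psi_3<1$, then $\lim_{\lambda\to0^+}\mathcal R$ exists and is finite. 2. If $(\psi_1+\psi_2)/\psi_3=1$, then $\lim_{\lambda\to0^+}\mathcal R=+\infty$. 3. If $1<(\psi_1+\psi_2)/\psi_3<1+\psi_2/\psi_1$, then $\lim_{\lambda\to0^+}\mathcal R$ exists and is finite for all $\mu_{2,1}\in\mathbb R$, $\mu_{2,2}>0$, and $\liminf_{\mu_{2,1}\to0,\ \mu_{2,2}\to0^+}\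 \lim_{\lambda\to0^+}\mathcal R<+\infty$. 4. If $(\psi_1+\psi_2)/\psi_3=1+\psi_2/\psi_1$, then $\lim_{\lambda\to0^+}\mathcal R$ exists and is finite for all $\mu_{2,1}\in\mathbb R$, $\mu_{2,2}>0$, and $\lim_{\mu_{2,1}\to0,\ \mu_{2,2}\to0^+}\ \lim_{\lambda\to0^+}\mathcal R=+\infty$. -/

import Mathlib

open Filter Topology

/-- The parameters of a double random feature model that enter the asymptotic risk: the limits
`ψ₁ = lim N₁ / d`, `ψ₂ = lim N₂ / d`, `ψ₃ = lim n / d`, and the spherical moments `μⱼ₁`, `μⱼ₂` of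
the two activation functions (`μⱼ₁ = E[G σⱼ(G)]`, `μⱼ₂² = E[σⱼ(G)²] - E[σⱼ(G)]² - μⱼ₁²` for a
standard normal `G`). -/
structure DRFMParams where
  ψ₁ : ℝ
  ψ₂ : ℝ
  ψ₃ : ℝ
  μ₁₁ : ℝ
  μ₁₂ : ℝ
  μ₂₁ : ℝ
  μ₂₂ : ℝ

namespace DRFMParams

/-- The open upper half plane `ℂ₊`. -/
def upperHalf : Set ℂ := {z | 0 < z.im}

/-- `(n₁, n₂, n₃)` solves the `ν`-system at `ξ`. -/
def NuSystem (P : DRFMParams) (ξ n₁ n₂ n₃ : ℂ) : Prop :=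
  n₁ * (-ξ - (P.μ₁₂ : ℂ) ^ 2 * n₃
      - (P.μ₁₁ : ℂ) ^ 2 * n₃ / (1 - (P.μ₂₁ : ℂ) ^ 2 * n₂ * n₃ - (P.μ₁₁ : ℂ) ^ 2 * n₁ * n₃))
    = (P.ψ₁ : ℂ) ∧
  n₂ * (-ξ - (P.μ₂₂ : ℂ) ^ 2 * n₃
      - (P.μ₂₁ : ℂ) ^ 2 * n₃ / (1 - (P.μ₁₁ : ℂ) ^ 2 * n₁ * n₃ - (P.μ₂₁ : ℂ) ^ 2 * n₂ * n₃))
    = (P.ψ₂ : ℂ) ∧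
  n₃ * (-ξ - (P.μ₁₂ : ℂ) ^ 2 * n₁ - (P.μ₂₂ : ℂ) ^ 2 * n₂
      - ((P.μ₁₁ : ℂ) ^ 2 * n₁ + (P.μ₂₁ : ℂ) ^ 2 * n₂)
        / (1 - (P.μ₁₁ : ℂ) ^ 2 * n₁ * n₃ - (P.μ₂₁ : ℂ) ^ 2 * n₂ * n₃))
    = (P.ψ₃ : ℂ)

/-- The properties that determine `ν = (ν₁, ν₂, ν₃) : ℂ₊ → ℂ₊³` (indices `0, 1, 2` here; values
off `ℂ₊` play no role): analyticity, the `ν`-system at every `ξ ∈ ℂ₊`, and a bound for large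
imaginary part. -/
structure IsNu (P : DRFMParams) (ν : ℂ → Fin 3 → ℂ) : Prop where
  analytic : ∀ j, DifferentiableOn ℂ (fun ξ => ν ξ j) upperHalf
  mapsTo : ∀ ξ ∈ upperHalf, ∀ j, ν ξ j ∈ upperHalf
  system : ∀ ξ ∈ upperHalf, P.NuSystem ξ (ν ξ 0) (ν ξ 1) (ν ξ 2)
  bound : ∃ ξ₀ : ℝ, 0 < ξ₀ ∧ ∀ ξ : ℂ, ξ₀ ≤ ξ.im →
    ‖ν ξ 0‖ ≤ 2 * P.ψ₁ / ξ₀ ∧ ‖ν ξ 1‖ ≤ 2 * P.ψ₂ / ξ₀ ∧ ‖ν ξ 2‖ ≤ 2 * P.ψ₃ / ξ₀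

/-- The function `ν` with these properties (an arbitrary function if there were none). -/
noncomputable def nu (P : DRFMParams) : ℂ → Fin 3 → ℂ :=
  Classical.epsilon P.IsNu

/-- `ν* = ν(√λ · i)`. -/
noncomputable def nuStar (P : DRFMParams) (lam : ℝ) : Fin 3 → ℂ :=
  P.nu ((Real.sqrt lam : ℂ) * Complex.I)

/-- `M_N = ν₁* μ₁₁² + ν₂* μ₂₁²`. -/
noncomputable def MN (P : DRFMParams) (lam : ℝ) : ℂ :=
  P.nuStar lam 0 * (P.μ₁₁ : ℂ) ^ 2 + P.nuStar lam 1 * (P.μ₂₁ : ℂ) ^ 2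

/-- `M_D = ν₃* M_N - 1`. -/
noncomputable def MD (P : DRFMParams) (lam : ℝ) : ℂ :=
  P.nuStar lam 2 * P.MN lam - 1

/-- The symmetric matrix `H`. -/
noncomputable def matH (P : DRFMParams) (lam : ℝ) : Matrix (Fin 3) (Fin 3) ℂ :=
  let n := P.nuStar lam
  let D := P.MD lam
  let a : ℂ := (P.μ₁₁ : ℂ) ^ 2
  let b : ℂ := (P.μ₂₁ : ℂ) ^ 2
  let c : ℂ := (P.μ₁₂ : ℂ) ^ 2
  let e : ℂ := (P.μ₂₂ : ℂ) ^ 2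
  !![-(n 2 ^ 2 * a ^ 2 / D ^ 2) + P.ψ₁ / n 0 ^ 2, -(n 2 ^ 2 * a * b / D ^ 2), -(a / D ^ 2) - c;
     -(n 2 ^ 2 * a * b / D ^ 2), -(n 2 ^ 2 * b ^ 2 / D ^ 2) + P.ψ₂ / n 1 ^ 2, -(b / D ^ 2) - e;
     -(a / D ^ 2) - c, -(b / D ^ 2) - e, -(P.MN lam ^ 2 / D ^ 2) + P.ψ₃ / n 2 ^ 2]

/-- The matrix `V`. -/
noncomputable def matV (P : DRFMParams) (lam : ℝ) : Matrix (Fin 3) (Fin 4) ℂ :=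
  let n := P.nuStar lam
  let D := P.MD lam
  let a : ℂ := (P.μ₁₁ : ℂ) ^ 2
  let b : ℂ := (P.μ₂₁ : ℂ) ^ 2
  let c : ℂ := (P.μ₁₂ : ℂ) ^ 2
  let e : ℂ := (P.μ₂₂ : ℂ) ^ 2
  !![c, 0, a / D ^ 2, n 2 ^ 2 * a / D ^ 2;
     e, 0, b / D ^ 2, n 2 ^ 2 * b / D ^ 2;
     0, 1, P.MN lam ^ 2 / D ^ 2, 1 / D ^ 2]

/-- The matrix `L = Vᵀ H⁻¹ V`; its entry `L_{i,j}` is `matL (i - 1) (j - 1)`. -/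
noncomputable def matL (P : DRFMParams) (lam : ℝ) : Matrix (Fin 4) (Fin 4) ℂ :=
  (P.matV lam).transpose * (P.matH lam)⁻¹ * P.matV lam

/-- The asymptotic excess risk
`F₁² (1 / M_D² + L_{3,4} + L_{1,4}) + τ² (L_{2,3} + L_{1,2})`. For `λ > 0` the numbers `νⱼ*` are
purely imaginary, so the expression is real; `.re` only changes its type. -/
noncomputable def risk (P : DRFMParams) (F₁ τ lam : ℝ) : ℝ :=
  ((F₁ : ℂ) ^ 2 * (1 / P.MD lam ^ 2 + P.matL lam 2 3 + P.matL lam 0 3)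
    + (τ : ℂ) ^ 2 * (P.matL lam 1 2 + P.matL lam 0 1)).re

end DRFMParams

/-!
For fixed `ξ` the equations say that `(ν₁, ν₂, ν₃)` is a fixed point of a holomorphic self-map of
the product of half planes with image in a bounded part of it. By the Schwarz–Pick lemma such a map
strictly contracts the hyperbolic metric, so the fixed point exists, is unique and depends
holomorphically on `ξ`. Uniqueness and the symmetry `ξ ↦ -conj ξ` make `ν(√λ i)` purely imaginary.

In the real variables `pᵢ = -νᵢν₃` and `k = √λ / |ν₃|` the equations and the risk remain meaningful
at `λ = 0`, and `H` becomes, up to a diagonal scaling, the grounded Laplacian of a triangle with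
nonnegative weights. Its inverse is entrywise nonnegative, so every term of the risk is nonnegative
and the risk blows up exactly when the determinant of the Laplacian tends to zero. At `λ = 0` that
happens at the interpolation threshold `ψ₁ + ψ₂ = ψ₃`, and, once the second activation degenerates,
at `ψ₁ = ψ₃`.
-/

section HyperbolicDistance

/-- The points `z` and `w` of the closed upper half plane satisfy `2 sinh (d(z, w) / 2) ≤ r` for the
hyperbolic distance `d`; the condition is multiplied out so that real points are allowed. -/
def HypClose (r : ℝ) (z w : ℂ) : Prop :=
  ‖z - w‖ ≤ r * (√z.im * √w.im)

variable {r : ℝ} {z w z' w' : ℂ}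

lemma ne_zero_of_im_pos (hz : 0 < z.im) : z ≠ 0 := by
  rintro rfl
  simp at hz

lemma im_le_norm (z : ℂ) : z.im ≤ ‖z‖ :=
  (le_abs_self _).trans z.abs_im_le_norm

lemma neg_inv_im (z : ℂ) : (-z⁻¹).im = z.im / ‖z‖ ^ 2 := by
  rw [Complex.neg_im, Complex.inv_im, neg_div, neg_neg, Complex.normSq_eq_norm_sq]

lemma neg_inv_im_nonneg (hz : 0 ≤ z.im) : 0 ≤ (-z⁻¹).im := by
  rw [neg_inv_im]
  positivity

lemma neg_inv_im_pos (hz : 0 < z.im) : 0 < (-z⁻¹).im := by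
  have : z ≠ 0 := ne_zero_of_im_pos hz
  rw [neg_inv_im]
  positivity

lemma sqrt_mul_sqrt_add_le {x y x' y' : ℝ} (hx : 0 ≤ x) (hy : 0 ≤ y) (hx' : 0 ≤ x') (hy' : 0 ≤ y') :
    √x * √y + √x' * √y' ≤ √(x + x') * √(y + y') := by
  rw [← Real.sqrt_mul (add_nonneg hx hx')]
  apply Real.le_sqrt_of_sq_le
  calc (√x * √y + √x' * √y') ^ 2
      = √x ^ 2 * √y ^ 2 + √x' ^ 2 * √y' ^ 2 + 2 * (√x * √y') * (√x' * √y) := by ring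
    _ ≤ √x ^ 2 * √y ^ 2 + √x' ^ 2 * √y' ^ 2 + ((√x * √y') ^ 2 + (√x' * √y) ^ 2) := by
        gcongr
        exact two_mul_le_add_sq _ _
    _ = (√x ^ 2 + √x' ^ 2) * (√y ^ 2 + √y' ^ 2) := by ring
    _ = (x + x') * (y + y') := by
        rw [Real.sq_sqrt hx, Real.sq_sqrt hy, Real.sq_sqrt hx', Real.sq_sqrt hy']

namespace HypClose

lemma add (hr : 0 ≤ r) (h : HypClose r z w) (h' : HypClose r z' w') (hz : 0 ≤ z.im)
    (hw : 0 ≤ w.im) (hz' : 0 ≤ z'.im) (hw' : 0 ≤ w'.im) : HypClose r (z + z') (w + w') := by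
  unfold HypClose at *
  calc ‖z + z' - (w + w')‖ = ‖(z - w) + (z' - w')‖ := by rw [add_sub_add_comm]
    _ ≤ ‖z - w‖ + ‖z' - w'‖ := norm_add_le _ _
    _ ≤ r * (√z.im * √w.im + √z'.im * √w'.im) := by
        rw [mul_add]
        exact add_le_add h h'
    _ ≤ r * (√(z + z').im * √(w + w').im) := by
        rw [Complex.add_im, Complex.add_im]
        gcongr
        exact sqrt_mul_sqrt_add_le hz hw hz' hw'

lemma ofReal_mul {t : ℝ} (ht : 0 ≤ t) (h : HypClose r z w) : HypClose r (t * z) (t * w) := by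
  unfold HypClose at *
  rw [← mul_sub, norm_mul, Complex.norm_real, Real.norm_of_nonneg ht, Complex.im_ofReal_mul,
    Complex.im_ofReal_mul, Real.sqrt_mul ht, Real.sqrt_mul ht]
  calc t * ‖z - w‖ ≤ t * (r * (√z.im * √w.im)) := by gcongr
    _ = (√t * √t) * (r * (√z.im * √w.im)) := by rw [Real.mul_self_sqrt ht]
    _ = r * (√t * √z.im * (√t * √w.im)) := by ring

lemma neg_inv (hz : z ≠ 0) (hw : w ≠ 0) (h : HypClose r z w) : HypClose r (-z⁻¹) (-w⁻¹) := by
  unfold HypClose at *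
  have hdiff : -z⁻¹ - -w⁻¹ = (z - w) * (z⁻¹ * w⁻¹) := by field_simp; ring
  rw [hdiff, norm_mul, norm_mul, norm_inv, norm_inv, neg_inv_im, neg_inv_im,
    Real.sqrt_div' _ (by positivity), Real.sqrt_div' _ (by positivity),
    Real.sqrt_sq (norm_nonneg _), Real.sqrt_sq (norm_nonneg _)]
  calc ‖z - w‖ * (‖z‖⁻¹ * ‖w‖⁻¹) ≤ r * (√z.im * √w.im) * (‖z‖⁻¹ * ‖w‖⁻¹) := by gcongr
    _ = r * (√z.im / ‖z‖ * (√w.im / ‖w‖)) := by ring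

lemma const_add {K η : ℝ} {ξ : ℂ} (hr : 0 ≤ r) (hη : 0 < η) (hξ : η ≤ ξ.im) (h : HypClose r z w)
    (hz : 0 ≤ z.im) (hw : 0 ≤ w.im) (hzK : z.im ≤ K) (hwK : w.im ≤ K) :
    HypClose (K / (K + η) * r) (ξ + z) (ξ + w) := by
  unfold HypClose at *
  have hK : 0 ≤ K := hz.trans hzK
  have le_mul_add {x : ℝ} (_ : 0 ≤ x) (hxK : x ≤ K) : x ≤ K / (K + η) * (ξ.im + x) := by
    rw [div_mul_eq_mul_div, le_div_iff₀ (by linarith)]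
    nlinarith
  have hq : 0 ≤ K / (K + η) := by positivity
  rw [Complex.add_im, Complex.add_im, add_sub_add_left_eq_sub]
  calc ‖z - w‖ ≤ r * (√z.im * √w.im) := h
    _ ≤ r * (√(K / (K + η) * (ξ.im + z.im)) * √(K / (K + η) * (ξ.im + w.im))) := by
        gcongr
        · exact le_mul_add hz hzK
        · exact le_mul_add hw hwK
    _ = r * ((√(K / (K + η)) * √(K / (K + η))) * (√(ξ.im + z.im) * √(ξ.im + w.im))) := by
        rw [Real.sqrt_mul hq, Real.sqrt_mul hq]
        ring
    _ = K / (K + η) * r * (√(ξ.im + z.im) * √(ξ.im + w.im)) := by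
        rw [Real.mul_self_sqrt hq]
        ring

end HypClose

end HyperbolicDistance

section Pick

/-- The open poly-upper half plane `ℂ₊^ι`. -/
def polyHalf (ι : Type*) : Set (ι → ℂ) := {n | ∀ j, 0 < (n j).im}

variable {ι : Type*}

lemma isOpen_polyHalf [Finite ι] : IsOpen (polyHalf ι) := by
  simp only [polyHalf, Set.ofPred_forall]
  exact isOpen_iInter_of_finite fun j =>
    isOpen_lt continuous_const (Complex.continuous_im.comp (continuous_apply j))

/-- Holomorphic functions from `ℂ₊^ι` to the closed upper half plane. The Schwarz–Pick lemma is not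
derived from these two properties but required as a third one, as it is easily checked along the
operations that build the functions used here. -/
structure IsPick (f : (ι → ℂ) → ℂ) : Prop where
  im_nonneg : ∀ n ∈ polyHalf ι, 0 ≤ (f n).im
  hypClose : ∀ r, 0 ≤ r → ∀ n ∈ polyHalf ι, ∀ m ∈ polyHalf ι,
    (∀ j, HypClose r (n j) (m j)) → HypClose r (f n) (f m)
  differentiableOn : DifferentiableOn ℂ f (polyHalf ι)

namespace IsPick

variable {f g : (ι → ℂ) → ℂ}

lemma congr (hf : IsPick f) (h : ∀ n ∈ polyHalf ι, g n = f n) : IsPick g where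
  im_nonneg n hn := h n hn ▸ hf.im_nonneg n hn
  hypClose r hr n hn m hm hnm := by
    rw [h n hn, h m hm]
    exact hf.hypClose r hr n hn m hm hnm
  differentiableOn := hf.differentiableOn.congr h

lemma zero : IsPick fun _ : ι → ℂ => 0 where
  im_nonneg _ _ := le_rfl
  hypClose _ _ _ _ _ _ _ := by simp [HypClose]
  differentiableOn := differentiableOn_const 0

lemma coord (j : ι) : IsPick fun n : ι → ℂ => n j where
  im_nonneg _ hn := (hn j).le
  hypClose _ _ _ _ _ _ h := h j
  differentiableOn := (differentiable_apply j).differentiableOn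

variable [Finite ι]

lemma add (hf : IsPick f) (hg : IsPick g) : IsPick fun n => f n + g n where
  im_nonneg n hn := add_nonneg (hf.im_nonneg n hn) (hg.im_nonneg n hn)
  hypClose r hr n hn m hm h := (hf.hypClose r hr n hn m hm h).add hr (hg.hypClose r hr n hn m hm h)
    (hf.im_nonneg n hn) (hf.im_nonneg m hm) (hg.im_nonneg n hn) (hg.im_nonneg m hm)
  differentiableOn := by
    have := Fintype.ofFinite ι
    exact hf.differentiableOn.add hg.differentiableOn

lemma ofReal_mul {t : ℝ} (ht : 0 ≤ t) (hf : IsPick f) : IsPick fun n => t * f n where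
  im_nonneg n hn := by
    rw [Complex.im_ofReal_mul]
    exact mul_nonneg ht (hf.im_nonneg n hn)
  hypClose r hr n hn m hm h := (hf.hypClose r hr n hn m hm h).ofReal_mul ht
  differentiableOn := by
    have := Fintype.ofFinite ι
    exact hf.differentiableOn.const_mul _

lemma neg_inv (hf : IsPick f) (hpos : ∀ n ∈ polyHalf ι, 0 < (f n).im) :
    IsPick fun n => -(f n)⁻¹ where
  im_nonneg n hn := neg_inv_im_nonneg (hf.im_nonneg n hn)
  hypClose r hr n hn m hm h := (hf.hypClose r hr n hn m hm h).neg_inv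
    (ne_zero_of_im_pos (hpos n hn)) (ne_zero_of_im_pos (hpos m hm))
  differentiableOn := by
    have := Fintype.ofFinite ι
    exact (hf.differentiableOn.inv fun n hn => ne_zero_of_im_pos (hpos n hn)).neg

end IsPick

lemma div_one_sub_mul_eq {z w : ℂ} (hz : z ≠ 0) : z / (1 - z * w) = -(w + -z⁻¹)⁻¹ := by
  have h : w + -z⁻¹ = -((1 - z * w) / z) := by field_simp; ring
  rw [h, inv_neg, neg_neg, inv_div]

lemma one_sub_mul_ne_zero {z w : ℂ} (hz : 0 < z.im) (hw : 0 ≤ w.im) : 1 - z * w ≠ 0 := by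
  have hz0 := ne_zero_of_im_pos hz
  have him : 0 < (w + -z⁻¹).im := by
    rw [Complex.add_im]
    linarith [neg_inv_im_pos hz]
  intro h
  apply ne_zero_of_im_pos him
  field_simp
  linear_combination -h

lemma IsPick.div_one_sub_mul [Finite ι] {f g : (ι → ℂ) → ℂ} (hf : IsPick f)
    (hpos : ∀ n ∈ polyHalf ι, 0 < (f n).im) (hg : IsPick g) :
    IsPick fun n => f n / (1 - f n * g n) := by
  refine ((hg.add (hf.neg_inv hpos)).neg_inv fun n hn => ?_).congr fun n hn =>
    div_one_sub_mul_eq (ne_zero_of_im_pos (hpos n hn))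
  exact add_pos_of_nonneg_of_pos (hg.im_nonneg n hn) (neg_inv_im_pos (hpos n hn))

lemma exists_hypClose [Finite ι] {n m : ι → ℂ} (hn : n ∈ polyHalf ι) (hm : m ∈ polyHalf ι) :
    ∃ r, 0 ≤ r ∧ ∀ j, HypClose r (n j) (m j) := by
  have := Fintype.ofFinite ι
  have hs (j) : 0 < √(n j).im * √(m j).im :=
    mul_pos (Real.sqrt_pos.2 (hn j)) (Real.sqrt_pos.2 (hm j))
  have hquot (j) : 0 ≤ ‖n j - m j‖ / (√(n j).im * √(m j).im) := by positivity
  refine ⟨∑ j, ‖n j - m j‖ / (√(n j).im * √(m j).im),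
    Finset.sum_nonneg fun j _ => hquot j, fun j => ?_⟩
  rw [HypClose, ← div_le_iff₀ (hs j)]
  exact Finset.single_le_sum (fun j _ => hquot j) (Finset.mem_univ j)

end Pick

section DysonEquation

variable {ι : Type*} {ψ : ι → ℝ} {η K R : ℝ} {n m : ι → ℂ} {ξ : ℂ} {S : ι → (ι → ℂ) → ℂ}

/-- The product of the closed horodiscs of Euclidean diameter `ψ j / η` tangent to the real axis at
the origin (without the point of tangency). One step of `dysonMap` lands here when `η ≤ im ξ`. -/
def horodisc (ψ : ι → ℝ) (η : ℝ) : Set (ι → ℂ) :=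
  {n | ∀ j, 0 < (n j).im ∧ η * ‖n j‖ ^ 2 ≤ ψ j * (n j).im}

/-- A self-energy for the Dyson equation `n j * (-ξ - S j n) = ψ j`: a family of Pick functions that
are bounded on horodiscs. -/
structure IsSelfEnergy (ψ : ι → ℝ) (S : ι → (ι → ℂ) → ℂ) : Prop where
  isPick : ∀ j, IsPick (S j)
  isBigO_one : ∀ η > 0, ∀ j, S j =O[𝓟 (horodisc ψ η)] fun _ => (1 : ℝ)

/-- The map whose fixed points in `ℂ₊^ι` are the solutions of the Dyson equation at `ξ`. -/
noncomputable def dysonMap (ψ : ι → ℝ) (S : ι → (ι → ℂ) → ℂ) (ξ : ℂ) (n : ι → ℂ) : ι → ℂ :=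
  fun j => ψ j * (-(ξ + S j n)⁻¹)

/-- The Picard iterates of the Dyson equation, from the second one on, after which all of them have
imaginary parts bounded below. -/
noncomputable def dysonIter (ψ : ι → ℝ) (S : ι → (ι → ℂ) → ℂ) (k : ℕ) (ξ : ℂ) : ι → ℂ :=
  (dysonMap ψ S ξ)^[k + 2] fun _ => Complex.I

/-- The limit of the Picard iterates of the Dyson equation at `ξ`. -/
noncomputable def dysonLim (ψ : ι → ℝ) (S : ι → (ι → ℂ) → ℂ) (ξ : ℂ) : ι → ℂ :=
  fun j => limUnder atTop fun k => dysonIter ψ S k ξ j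

lemma horodisc_subset_polyHalf : horodisc ψ η ⊆ polyHalf ι := fun _ hn j => (hn j).1

lemma pos_of_mem_horodisc (hη : 0 < η) (hn : n ∈ horodisc ψ η) (j : ι) : 0 < ψ j := by
  obtain ⟨him, hle⟩ := hn j
  have := ne_zero_of_im_pos him
  exact pos_of_mul_pos_left ((by positivity : 0 < η * ‖n j‖ ^ 2).trans_le hle) him.le

lemma norm_le_of_mem_horodisc (hη : 0 < η) (hn : n ∈ horodisc ψ η) (j : ι) : ‖n j‖ ≤ ψ j / η := by
  have hpos : 0 < ‖n j‖ := norm_pos_iff.2 (ne_zero_of_im_pos (hn j).1)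
  have hψ := pos_of_mem_horodisc hη hn j
  rw [le_div_iff₀ hη]
  refine le_of_mul_le_mul_right ?_ hpos
  calc ‖n j‖ * η * ‖n j‖ = η * ‖n j‖ ^ 2 := by ring
    _ ≤ ψ j * (n j).im := (hn j).2
    _ ≤ ψ j * ‖n j‖ := by gcongr; exact im_le_norm _

lemma isBigO_one_coord (hη : 0 < η) (j : ι) :
    (fun n : ι → ℂ => n j) =O[𝓟 (horodisc ψ η)] fun _ => (1 : ℝ) :=
  Asymptotics.isBigO_principal.2
    ⟨ψ j / η, fun n hn => by simpa using norm_le_of_mem_horodisc hη hn j⟩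

lemma isBigO_one_div_one_sub_mul (hη : 0 < η) (j : ι) {f : (ι → ℂ) → ℂ}
    (hf : ∀ n ∈ horodisc ψ η, 0 ≤ (f n).im) :
    (fun n => n j / (1 - n j * f n)) =O[𝓟 (horodisc ψ η)] fun _ => (1 : ℝ) := by
  refine Asymptotics.isBigO_principal.2 ⟨ψ j / η, fun n hn => ?_⟩
  have hψ := pos_of_mem_horodisc hη hn j
  have hpos : 0 < ‖n j‖ := norm_pos_iff.2 (ne_zero_of_im_pos (hn j).1)
  have him : η / ψ j ≤ (f n + -(n j)⁻¹).im := calc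
    η / ψ j ≤ (n j).im / ‖n j‖ ^ 2 := by
      rw [div_le_div_iff₀ hψ (by positivity), mul_comm (n j).im]
      exact (hn j).2
    _ ≤ (f n + -(n j)⁻¹).im := by
      rw [Complex.add_im, neg_inv_im]
      exact le_add_of_nonneg_left (hf n hn)
  rw [div_one_sub_mul_eq (norm_pos_iff.1 hpos), norm_neg, norm_inv, norm_one, mul_one, ← inv_div]
  exact inv_anti₀ (by positivity) (him.trans (im_le_norm _))

lemma le_im_add_apply {j : ι} (hS : IsPick (S j)) (hξ : η ≤ ξ.im) (hn : n ∈ polyHalf ι) :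
    η ≤ (ξ + S j n).im :=
  hξ.trans (le_add_of_nonneg_right (hS.im_nonneg n hn))

namespace IsSelfEnergy

lemma exists_norm_le [Finite ι] (hS : IsSelfEnergy ψ S) (hη : 0 < η) :
    ∃ K, 0 ≤ K ∧ ∀ n ∈ horodisc ψ η, ∀ j, ‖S j n‖ ≤ K := by
  choose K hK using fun j => Asymptotics.isBigO_principal.1 (hS.isBigO_one η hη j)
  obtain ⟨M, hM⟩ := Set.finite_range K |>.bddAbove
  refine ⟨max M 0, le_max_right _ _, fun n hn j => ?_⟩
  have hSn : ‖S j n‖ ≤ K j := by simpa using hK j n hn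
  exact hSn.trans ((hM ⟨j, rfl⟩).trans (le_max_left _ _))

lemma dysonMap_mem_horodisc (hS : IsSelfEnergy ψ S) (hψ : ∀ j, 0 < ψ j) (hη : 0 < η)
    (hξ : η ≤ ξ.im) (hn : n ∈ polyHalf ι) : dysonMap ψ S ξ n ∈ horodisc ψ η := by
  intro j
  have him : η ≤ (ξ + S j n).im := le_im_add_apply (hS.isPick j) hξ hn
  have hψj := hψ j
  rw [dysonMap, Complex.im_ofReal_mul]
  refine ⟨mul_pos hψj (neg_inv_im_pos (hη.trans_le him)), ?_⟩
  rw [neg_inv_im, norm_mul, Complex.norm_real, Real.norm_of_nonneg hψj.le, norm_neg, norm_inv]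
  calc η * (ψ j * ‖ξ + S j n‖⁻¹) ^ 2 = ψ j * (ψ j * (η / ‖ξ + S j n‖ ^ 2)) := by ring
    _ ≤ ψ j * (ψ j * ((ξ + S j n).im / ‖ξ + S j n‖ ^ 2)) := by gcongr

lemma iterate_dysonMap_mem_horodisc (hS : IsSelfEnergy ψ S) (hψ : ∀ j, 0 < ψ j) (hη : 0 < η)
    (hξ : η ≤ ξ.im) (hn : n ∈ horodisc ψ η) (k : ℕ) : (dysonMap ψ S ξ)^[k] n ∈ horodisc ψ η :=
  Set.MapsTo.iterate (fun _ hm => hS.dysonMap_mem_horodisc hψ hη hξ (horodisc_subset_polyHalf hm))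
    k hn

lemma hypClose_iterate (hS : IsSelfEnergy ψ S) (hψ : ∀ j, 0 < ψ j) (hη : 0 < η) (hξ : η ≤ ξ.im)
    (hK : 0 ≤ K) (hSK : ∀ n ∈ horodisc ψ η, ∀ j, ‖S j n‖ ≤ K)
    (hn : n ∈ horodisc ψ η) (hm : m ∈ horodisc ψ η) {r : ℝ} (hr : 0 ≤ r)
    (h : ∀ j, HypClose r (n j) (m j)) (k : ℕ) (j : ι) :
    HypClose ((K / (K + η)) ^ k * r) ((dysonMap ψ S ξ)^[k] n j) ((dysonMap ψ S ξ)^[k] m j) := by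
  induction k generalizing j with
  | zero => simpa using h j
  | succ k ih =>
    rw [Function.iterate_succ_apply', Function.iterate_succ_apply', pow_succ', mul_assoc]
    have hn' := hS.iterate_dysonMap_mem_horodisc hψ hη hξ hn k
    have hm' := hS.iterate_dysonMap_mem_horodisc hψ hη hξ hm k
    generalize (dysonMap ψ S ξ)^[k] n = n' at *
    generalize (dysonMap ψ S ξ)^[k] m = m' at *
    have hpn := horodisc_subset_polyHalf hn'
    have hpm := horodisc_subset_polyHalf hm'
    have hr' : 0 ≤ (K / (K + η)) ^ k * r := by positivity
    have hclose := ((hS.isPick j).hypClose _ hr' n' hpn m' hpm ih).const_add hr' hη hξ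
      ((hS.isPick j).im_nonneg n' hpn) ((hS.isPick j).im_nonneg m' hpm)
      ((im_le_norm _).trans (hSK n' hn' j)) ((im_le_norm _).trans (hSK m' hm' j))
    exact (hclose.neg_inv
      (ne_zero_of_im_pos (hη.trans_le (le_im_add_apply (hS.isPick j) hξ hpn)))
      (ne_zero_of_im_pos (hη.trans_le (le_im_add_apply (hS.isPick j) hξ hpm)))).ofReal_mul (hψ j).le

lemma eq_of_isFixedPt [Finite ι] (hS : IsSelfEnergy ψ S) (hψ : ∀ j, 0 < ψ j) (hξ : 0 < ξ.im)
    (hn : n ∈ polyHalf ι) (hm : m ∈ polyHalf ι) (hfn : Function.IsFixedPt (dysonMap ψ S ξ) n)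
    (hfm : Function.IsFixedPt (dysonMap ψ S ξ) m) : n = m := by
  have hn' : n ∈ horodisc ψ ξ.im := hfn ▸ hS.dysonMap_mem_horodisc hψ hξ le_rfl hn
  have hm' : m ∈ horodisc ψ ξ.im := hfm ▸ hS.dysonMap_mem_horodisc hψ hξ le_rfl hm
  obtain ⟨K, hK, hSK⟩ := hS.exists_norm_le hξ
  obtain ⟨r, hr, hclose⟩ := exists_hypClose hn hm
  have hpow : Tendsto (fun k => (K / (K + ξ.im)) ^ k) atTop (𝓝 0) :=
    tendsto_pow_atTop_nhds_zero_of_lt_one (by positivity) <|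
      (div_lt_one (by positivity)).2 (by simpa)
  funext j
  have hlim := (hpow.mul_const r).mul_const (√(n j).im * √(m j).im)
  have hle : ‖n j - m j‖ ≤ 0 * r * (√(n j).im * √(m j).im) := ge_of_tendsto' hlim fun k => by
    have h := hS.hypClose_iterate hψ hξ le_rfl hK hSK hn' hm' hr hclose k j
    rwa [hfn.iterate k, hfm.iterate k] at h
  rw [zero_mul, zero_mul] at hle
  exact sub_eq_zero.1 (norm_le_zero_iff.1 hle)

lemma le_im_dysonMap (hS : IsSelfEnergy ψ S) (hη : 0 < η) (hξ : η ≤ ξ.im) (hR : ‖ξ‖ ≤ R)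
    (hSK : ∀ n ∈ horodisc ψ η, ∀ j, ‖S j n‖ ≤ K)
    (hn : n ∈ horodisc ψ η) (j : ι) : ψ j * (η / (R + K) ^ 2) ≤ (dysonMap ψ S ξ n j).im := by
  have hψ := pos_of_mem_horodisc hη hn j
  have him := le_im_add_apply (hS.isPick j) hξ (horodisc_subset_polyHalf hn)
  have hnorm : ‖ξ + S j n‖ ≤ R + K := norm_add_le_of_le hR (hSK n hn j)
  have hpos : 0 < ‖ξ + S j n‖ := norm_pos_iff.2 (ne_zero_of_im_pos (hη.trans_le him))
  rw [dysonMap, Complex.im_ofReal_mul, neg_inv_im]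
  have := hη.le.trans him
  gcongr

lemma dysonIter_mem_horodisc (hS : IsSelfEnergy ψ S) (hψ : ∀ j, 0 < ψ j) (hη : 0 < η)
    (hξ : η ≤ ξ.im) (k : ℕ) : dysonIter ψ S k ξ ∈ horodisc ψ η := by
  have hI : (fun _ => Complex.I) ∈ polyHalf ι := fun _ => by simp
  rw [dysonIter, Function.iterate_succ_apply]
  exact hS.iterate_dysonMap_mem_horodisc hψ hη hξ (hS.dysonMap_mem_horodisc hψ hη hξ hI) _

lemma le_im_dysonIter (hS : IsSelfEnergy ψ S) (hψ : ∀ j, 0 < ψ j) (hη : 0 < η) (hξ : η ≤ ξ.im)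
    (hR : ‖ξ‖ ≤ R) (hSK : ∀ n ∈ horodisc ψ η, ∀ j, ‖S j n‖ ≤ K) (k : ℕ) (j : ι) :
    ψ j * (η / (R + K) ^ 2) ≤ (dysonIter ψ S k ξ j).im := by
  have hI : (fun _ => Complex.I) ∈ polyHalf ι := fun _ => by simp
  rw [dysonIter, Function.iterate_succ_apply, Function.iterate_succ_apply']
  exact hS.le_im_dysonMap hη hξ hR hSK
    (hS.iterate_dysonMap_mem_horodisc hψ hη hξ (hS.dysonMap_mem_horodisc hψ hη hξ hI) k) j

lemma hypClose_dysonIter_zero_one (hS : IsSelfEnergy ψ S) (hψ : ∀ j, 0 < ψ j) (hη : 0 < η)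
    (hξ : η ≤ ξ.im) (hR : ‖ξ‖ ≤ R) (hK : 0 ≤ K) (hSK : ∀ n ∈ horodisc ψ η, ∀ j, ‖S j n‖ ≤ K)
    (j : ι) :
    HypClose (2 * (R + K) ^ 2 / η ^ 2) (dysonIter ψ S 0 ξ j) (dysonIter ψ S 1 ξ j) := by
  have hRpos : 0 < R := hη.trans_le (hξ.trans ((im_le_norm ξ).trans hR))
  have hψj := hψ j
  have hnorm (k) := norm_le_of_mem_horodisc hη (hS.dysonIter_mem_horodisc hψ hη hξ k) j
  have him := hS.le_im_dysonIter hψ hη hξ hR hSK (j := j)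
  calc ‖dysonIter ψ S 0 ξ j - dysonIter ψ S 1 ξ j‖ ≤ ψ j / η + ψ j / η :=
        (norm_sub_le _ _).trans (add_le_add (hnorm 0) (hnorm 1))
    _ = 2 * (R + K) ^ 2 / η ^ 2 * (ψ j * (η / (R + K) ^ 2)) := by field_simp; ring
    _ = 2 * (R + K) ^ 2 / η ^ 2 * (√(ψ j * (η / (R + K) ^ 2)) * √(ψ j * (η / (R + K) ^ 2))) := by
        rw [Real.mul_self_sqrt (by positivity)]
    _ ≤ 2 * (R + K) ^ 2 / η ^ 2 * (√(dysonIter ψ S 0 ξ j).im * √(dysonIter ψ S 1 ξ j).im) := by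
        gcongr
        · exact him 0
        · exact him 1

lemma dist_dysonIter_le (hS : IsSelfEnergy ψ S) (hψ : ∀ j, 0 < ψ j) (hη : 0 < η) (hξ : η ≤ ξ.im)
    (hR : ‖ξ‖ ≤ R) (hK : 0 ≤ K) (hSK : ∀ n ∈ horodisc ψ η, ∀ j, ‖S j n‖ ≤ K) (k : ℕ) (j : ι) :
    dist (dysonIter ψ S k ξ j) (dysonIter ψ S (k + 1) ξ j) ≤
      2 * (R + K) ^ 2 / η ^ 2 * (ψ j / η) * (K / (K + η)) ^ k := by
  have hmem := hS.dysonIter_mem_horodisc hψ hη hξ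
  have hψj := hψ j
  have him (k) : (dysonIter ψ S k ξ j).im ≤ ψ j / η :=
    (im_le_norm _).trans (norm_le_of_mem_horodisc hη (hmem k) j)
  have hclose : HypClose ((K / (K + η)) ^ k * (2 * (R + K) ^ 2 / η ^ 2)) (dysonIter ψ S k ξ j)
      (dysonIter ψ S (k + 1) ξ j) := by
    have h := hS.hypClose_iterate hψ hη hξ hK hSK (hmem 0) (hmem 1) (by positivity)
      (hS.hypClose_dysonIter_zero_one hψ hη hξ hR hK hSK) k j
    simpa only [dysonIter, ← Function.iterate_add_apply, ← add_assoc] using h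
  rw [dist_eq_norm]
  calc ‖dysonIter ψ S k ξ j - dysonIter ψ S (k + 1) ξ j‖
      ≤ (K / (K + η)) ^ k * (2 * (R + K) ^ 2 / η ^ 2) * (√(ψ j / η) * √(ψ j / η)) := by
        refine hclose.trans ?_
        gcongr
        · exact him k
        · exact him (k + 1)
    _ = 2 * (R + K) ^ 2 / η ^ 2 * (ψ j / η) * (K / (K + η)) ^ k := by
        rw [Real.mul_self_sqrt (by positivity)]
        ring

lemma tendsto_dysonIter [Finite ι] (hS : IsSelfEnergy ψ S) (hψ : ∀ j, 0 < ψ j) (hξ : 0 < ξ.im)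
    (j : ι) : Tendsto (fun k => dysonIter ψ S k ξ j) atTop (𝓝 (dysonLim ψ S ξ j)) := by
  obtain ⟨K, hK, hSK⟩ := hS.exists_norm_le hξ
  exact (cauchySeq_of_le_geometric _ _ ((div_lt_one (by positivity)).2 (by simpa))
    fun k => hS.dist_dysonIter_le hψ hξ le_rfl le_rfl hK hSK k j).tendsto_limUnder

lemma dysonLim_mem_polyHalf [Finite ι] (hS : IsSelfEnergy ψ S) (hψ : ∀ j, 0 < ψ j) (hξ : 0 < ξ.im) :
    dysonLim ψ S ξ ∈ polyHalf ι := by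
  intro j
  obtain ⟨K, hK, hSK⟩ := hS.exists_norm_le hξ
  have hψj := hψ j
  have hξ0 : ξ ≠ 0 := ne_zero_of_im_pos hξ
  have hpos : 0 < ψ j * (ξ.im / (‖ξ‖ + K) ^ 2) := by positivity
  exact hpos.trans_le (ge_of_tendsto' ((Complex.continuous_im.tendsto _).comp
    (hS.tendsto_dysonIter hψ hξ j)) fun k => hS.le_im_dysonIter hψ hξ le_rfl le_rfl hSK k j)

lemma isFixedPt_dysonLim [Finite ι] (hS : IsSelfEnergy ψ S) (hψ : ∀ j, 0 < ψ j) (hξ : 0 < ξ.im) :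
    Function.IsFixedPt (dysonMap ψ S ξ) (dysonLim ψ S ξ) := by
  have hmem := hS.dysonLim_mem_polyHalf hψ hξ
  have hlim : Tendsto (fun k => dysonIter ψ S k ξ) atTop (𝓝 (dysonLim ψ S ξ)) :=
    tendsto_pi_nhds.2 (hS.tendsto_dysonIter hψ hξ)
  funext j
  have hcont : ContinuousAt (S j) (dysonLim ψ S ξ) :=
    (hS.isPick j).differentiableOn.continuousOn.continuousAt (isOpen_polyHalf.mem_nhds hmem)
  have hstep : Tendsto (fun k => dysonMap ψ S ξ (dysonIter ψ S k ξ) j) atTop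
      (𝓝 (dysonMap ψ S ξ (dysonLim ψ S ξ) j)) :=
    (((hcont.tendsto.comp hlim).const_add ξ).inv₀ (ne_zero_of_im_pos
      (hξ.trans_le (le_im_add_apply (hS.isPick j) le_rfl hmem)))).neg.const_mul _
  refine tendsto_nhds_unique hstep (((hS.tendsto_dysonIter hψ hξ j).comp
    (tendsto_add_atTop_nat 1)).congr fun k => ?_)
  exact congrFun (Function.iterate_succ_apply' _ _ _) j

lemma differentiableOn_iterate_dysonMap [Finite ι] (hS : IsSelfEnergy ψ S) (hψ : ∀ j, 0 < ψ j)
    (k : ℕ) :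
    DifferentiableOn ℂ (fun ξ => (dysonMap ψ S ξ)^[k] fun _ => Complex.I) {ξ | 0 < ξ.im} := by
  have := Fintype.ofFinite ι
  have hmem (k : ℕ) : Set.MapsTo (fun ξ => (dysonMap ψ S ξ)^[k] fun _ => Complex.I)
      {ξ | 0 < ξ.im} (polyHalf ι) := fun ξ hξ =>
    Set.MapsTo.iterate (fun _ hm => horodisc_subset_polyHalf
      (hS.dysonMap_mem_horodisc hψ hξ le_rfl hm)) k fun _ => by simp
  induction k with
  | zero => exact differentiableOn_const _
  | succ k ih =>
    simp only [Function.iterate_succ_apply']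
    refine differentiableOn_pi.2 fun j => DifferentiableOn.const_mul (DifferentiableOn.neg
      ((differentiableOn_id.add ((hS.isPick j).differentiableOn.comp ih (hmem k))).inv
        fun ξ hξ => ?_)) _
    exact ne_zero_of_im_pos (hξ.trans_le (le_im_add_apply (hS.isPick j) le_rfl (hmem k hξ)))

lemma differentiableOn_dysonLim [Finite ι] (hS : IsSelfEnergy ψ S) (hψ : ∀ j, 0 < ψ j) (j : ι) :
    DifferentiableOn ℂ (fun ξ => dysonLim ψ S ξ j) {ξ | 0 < ξ.im} := by
  have := Fintype.ofFinite ι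
  have hopen (c : ℝ) : IsOpen {ξ : ℂ | c < ξ.im} := isOpen_lt continuous_const Complex.continuous_im
  refine TendstoLocallyUniformlyOn.differentiableOn (φ := atTop)
    (F := fun k ξ => dysonIter ψ S k ξ j) ?_ (Eventually.of_forall fun k =>
      differentiableOn_pi.1 (hS.differentiableOn_iterate_dysonMap hψ (k + 2)) j) (hopen 0)
  rw [Metric.tendstoLocallyUniformlyOn_iff]
  intro ε hε ξ hξ
  have hη : 0 < ξ.im / 2 := half_pos hξ
  obtain ⟨K, hK, hSK⟩ := hS.exists_norm_le hη
  have hq : K / (K + ξ.im / 2) < 1 := (div_lt_one (by positivity)).2 (by simpa)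
  set C := 2 * ((‖ξ‖ + 1) + K) ^ 2 / (ξ.im / 2) ^ 2 * (ψ j / (ξ.im / 2))
  have hlim : Tendsto (fun k : ℕ => C * (K / (K + ξ.im / 2)) ^ k / (1 - K / (K + ξ.im / 2)))
      atTop (𝓝 0) := by
    simpa using ((tendsto_pow_atTop_nhds_zero_of_lt_one (by positivity) hq).const_mul C).div_const
      (1 - K / (K + ξ.im / 2))
  refine ⟨{z | ξ.im / 2 < z.im} ∩ {z | ‖z‖ < ‖ξ‖ + 1}, mem_nhdsWithin_of_mem_nhds
    (((hopen _).inter (isOpen_lt continuous_norm continuous_const)).mem_nhds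
      ⟨show ξ.im / 2 < ξ.im from half_lt_self hξ, lt_add_one ‖ξ‖⟩), ?_⟩
  filter_upwards [hlim.eventually (gt_mem_nhds hε)] with k hk z ⟨him, hnorm⟩
  rw [dist_comm]
  refine lt_of_le_of_lt ?_ hk
  exact dist_le_of_le_geometric_of_tendsto _ C hq
    (fun k => hS.dist_dysonIter_le hψ hη (le_of_lt him) (le_of_lt hnorm) hK hSK k j)
    (hS.tendsto_dysonIter hψ (hη.trans him) j) k

end IsSelfEnergy

end DysonEquation

namespace DRFMParams

section NuSystem

variable {P : DRFMParams} {ξ : ℂ} {n m : Fin 3 → ℂ}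

/-- The self-energies of the `ν`-system. -/
noncomputable def selfEnergy (P : DRFMParams) : Fin 3 → (Fin 3 → ℂ) → ℂ :=
  let S := fun n : Fin 3 → ℂ => ↑(P.μ₁₁ ^ 2) * n 0 + ↑(P.μ₂₁ ^ 2) * n 1
  ![fun n => ↑(P.μ₁₂ ^ 2) * n 2 + ↑(P.μ₁₁ ^ 2) * (n 2 / (1 - n 2 * S n)),
    fun n => ↑(P.μ₂₂ ^ 2) * n 2 + ↑(P.μ₂₁ ^ 2) * (n 2 / (1 - n 2 * S n)),
    fun n => ↑(P.μ₁₂ ^ 2) * n 0 + ↑(P.μ₂₂ ^ 2) * n 1 + S n / (1 - S n * n 2)]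

lemma isPick_weightedSum (s t : ℝ) :
    IsPick fun n : Fin 3 → ℂ => ↑(s ^ 2) * n 0 + ↑(t ^ 2) * n 1 :=
  ((IsPick.coord 0).ofReal_mul (sq_nonneg s)).add ((IsPick.coord 1).ofReal_mul (sq_nonneg t))

lemma isPick_weightedSum_div (s t : ℝ) :
    IsPick fun n : Fin 3 → ℂ => (↑(s ^ 2) * n 0 + ↑(t ^ 2) * n 1) /
      (1 - (↑(s ^ 2) * n 0 + ↑(t ^ 2) * n 1) * n 2) := by
  by_cases h0 : s = 0 ∧ t = 0
  · simpa [h0.1, h0.2] using IsPick.zero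
  · refine (isPick_weightedSum s t).div_one_sub_mul (fun n hn => ?_) (IsPick.coord 2)
    have hn0 := hn 0
    have hn1 := hn 1
    rw [Complex.add_im, Complex.im_ofReal_mul, Complex.im_ofReal_mul]
    rcases not_and_or.1 h0 with hs | ht <;> positivity

lemma isPick_selfEnergy (P : DRFMParams) (j : Fin 3) : IsPick (P.selfEnergy j) := by
  have hdiv : IsPick fun n : Fin 3 → ℂ =>
      n 2 / (1 - n 2 * (↑(P.μ₁₁ ^ 2) * n 0 + ↑(P.μ₂₁ ^ 2) * n 1)) :=
    (IsPick.coord 2).div_one_sub_mul (fun n hn => hn 2) (isPick_weightedSum _ _)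
  fin_cases j
  · exact ((IsPick.coord 2).ofReal_mul (sq_nonneg _)).add (hdiv.ofReal_mul (sq_nonneg _))
  · exact ((IsPick.coord 2).ofReal_mul (sq_nonneg _)).add (hdiv.ofReal_mul (sq_nonneg _))
  · exact (isPick_weightedSum _ _).add (isPick_weightedSum_div _ _)

lemma isSelfEnergy_selfEnergy (P : DRFMParams) (ψ : Fin 3 → ℝ) : IsSelfEnergy ψ P.selfEnergy where
  isPick := P.isPick_selfEnergy
  isBigO_one η hη j := by
    have hcoord := isBigO_one_coord (ψ := ψ) hη
    have him (n : Fin 3 → ℂ) (hn : n ∈ horodisc ψ η) :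
        0 ≤ (↑(P.μ₁₁ ^ 2) * n 0 + ↑(P.μ₂₁ ^ 2) * n 1).im :=
      (isPick_weightedSum _ _).im_nonneg n (horodisc_subset_polyHalf hn)
    have hS := ((hcoord 0).const_mul_left (P.μ₁₁ ^ 2 : ℝ)).add
      ((hcoord 1).const_mul_left (P.μ₂₁ ^ 2 : ℝ))
    have hdiv := isBigO_one_div_one_sub_mul hη 2 him
    fin_cases j
    · exact ((hcoord 2).const_mul_left _).add (hdiv.const_mul_left _)
    · exact ((hcoord 2).const_mul_left _).add (hdiv.const_mul_left _)
    · refine (((hcoord 0).const_mul_left _).add ((hcoord 1).const_mul_left _)).add ?_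
      have hexpand := hS.add (((hS.mul hS).mul hdiv).congr_right fun _ => by ring)
      refine hexpand.congr' (eventually_principal.2 fun n hn => ?_) EventuallyEq.rfl
      have hne := one_sub_mul_ne_zero (hn 2).1 (him n hn)
      have hne' := mul_comm (n 2) _ ▸ hne
      field_simp
      ring

lemma nuSystem_iff_isFixedPt (hξ : 0 < ξ.im) (hn : n ∈ polyHalf (Fin 3)) :
    P.NuSystem ξ (n 0) (n 1) (n 2) ↔
      Function.IsFixedPt (dysonMap ![P.ψ₁, P.ψ₂, P.ψ₃] P.selfEnergy ξ) n := by
  have hne (j) : ξ + P.selfEnergy j n ≠ 0 :=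
    ne_zero_of_im_pos (hξ.trans_le (le_im_add_apply (P.isPick_selfEnergy j) le_rfl hn))
  have mul_eq_iff {ψ x w y : ℂ} (hw : w ≠ 0) (hy : w = -y) : x * y = ψ ↔ ψ * -w⁻¹ = x := by
    obtain rfl : y = -w := by rw [hy, neg_neg]
    constructor
    · rintro rfl
      field_simp
    · rintro rfl
      field_simp
  rw [Function.IsFixedPt, funext_iff, Fin.forall_fin_succ, Fin.forall_fin_two,
    Fin.succ_zero_eq_one, Fin.succ_one_eq_two]
  refine and_congr (mul_eq_iff (hne 0) ?_) (and_congr (mul_eq_iff (hne 1) ?_)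
    (mul_eq_iff (hne 2) ?_))
  · simp only [selfEnergy, Matrix.cons_val_zero, Complex.ofReal_pow]
    ring_nf
  · simp only [selfEnergy, Matrix.cons_val_one, Matrix.cons_val_zero, Complex.ofReal_pow]
    ring_nf
  · simp only [selfEnergy, Matrix.cons_val, Complex.ofReal_pow]
    ring_nf

lemma nuSystem_unique (h₁ : 0 < P.ψ₁) (h₂ : 0 < P.ψ₂) (h₃ : 0 < P.ψ₃) (hξ : 0 < ξ.im)
    (hn : n ∈ polyHalf (Fin 3)) (hm : m ∈ polyHalf (Fin 3))
    (hsn : P.NuSystem ξ (n 0) (n 1) (n 2)) (hsm : P.NuSystem ξ (m 0) (m 1) (m 2)) : n = m :=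
  (P.isSelfEnergy_selfEnergy _).eq_of_isFixedPt
    (Fin.forall_fin_succ.2 ⟨h₁, Fin.forall_fin_two.2 ⟨h₂, h₃⟩⟩) hξ hn hm
    ((nuSystem_iff_isFixedPt hξ hn).1 hsn) ((nuSystem_iff_isFixedPt hξ hm).1 hsm)

lemma exists_isNu (h₁ : 0 < P.ψ₁) (h₂ : 0 < P.ψ₂) (h₃ : 0 < P.ψ₃) : ∃ ν, P.IsNu ν := by
  have hψ : ∀ j, 0 < ![P.ψ₁, P.ψ₂, P.ψ₃] j :=
    Fin.forall_fin_succ.2 ⟨h₁, Fin.forall_fin_two.2 ⟨h₂, h₃⟩⟩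
  have hS := P.isSelfEnergy_selfEnergy ![P.ψ₁, P.ψ₂, P.ψ₃]
  have hmem {ξ : ℂ} (hξ : 0 < ξ.im) := hS.dysonLim_mem_polyHalf hψ hξ
  have hfix {ξ : ℂ} (hξ : 0 < ξ.im) := hS.isFixedPt_dysonLim hψ hξ
  refine ⟨dysonLim ![P.ψ₁, P.ψ₂, P.ψ₃] P.selfEnergy, hS.differentiableOn_dysonLim hψ,
    fun ξ hξ => hmem hξ, fun ξ hξ => (nuSystem_iff_isFixedPt hξ (hmem hξ)).2 (hfix hξ),
    1, one_pos, fun ξ hξ => ?_⟩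
  have hξ' : 0 < ξ.im := one_pos.trans_le hξ
  have hhoro : dysonLim ![P.ψ₁, P.ψ₂, P.ψ₃] P.selfEnergy ξ ∈ horodisc ![P.ψ₁, P.ψ₂, P.ψ₃] 1 := by
    rw [← hfix hξ']
    exact hS.dysonMap_mem_horodisc hψ one_pos hξ (hmem hξ')
  have hle (j) := norm_le_of_mem_horodisc one_pos hhoro j
  refine ⟨(hle 0).trans ?_, (hle 1).trans ?_, (hle 2).trans ?_⟩ <;>
  · simp only [Matrix.cons_val]
    linarith

lemma isNu_nu (h₁ : 0 < P.ψ₁) (h₂ : 0 < P.ψ₂) (h₃ : 0 < P.ψ₃) : P.IsNu P.nu :=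
  Classical.epsilon_spec (exists_isNu h₁ h₂ h₃)

open scoped ComplexConjugate in
lemma NuSystem.neg_conj {n₁ n₂ n₃ : ℂ} (h : P.NuSystem ξ n₁ n₂ n₃) :
    P.NuSystem (-conj ξ) (-conj n₁) (-conj n₂) (-conj n₃) := by
  obtain ⟨eq₁, eq₂, eq₃⟩ := h
  have eq₁' := congrArg conj eq₁
  have eq₂' := congrArg conj eq₂
  have eq₃' := congrArg conj eq₃
  simp only [map_mul, map_sub, map_neg, map_div₀, map_add, map_pow, map_one,
    Complex.conj_ofReal] at eq₁' eq₂' eq₃'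
  simp only [NuSystem, mul_neg, neg_mul, neg_neg]
  refine ⟨?_, ?_, ?_⟩
  · rw [← eq₁']
    ring
  · rw [← eq₂']
    ring
  · rw [← eq₃']
    ring

lemma sqrt_mul_I_im_pos {lam : ℝ} (hlam : 0 < lam) : 0 < (√lam * Complex.I : ℂ).im := by
  simpa [Complex.im_ofReal_mul] using hlam

lemma nuStar_eq_im_mul_I (h₁ : 0 < P.ψ₁) (h₂ : 0 < P.ψ₂) (h₃ : 0 < P.ψ₃) {lam : ℝ}
    (hlam : 0 < lam) (j : Fin 3) : P.nuStar lam j = (P.nuStar lam j).im * Complex.I := by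
  have hnu := isNu_nu h₁ h₂ h₃
  have hξ := sqrt_mul_I_im_pos hlam
  have hmem : P.nuStar lam ∈ polyHalf (Fin 3) := hnu.mapsTo _ hξ
  have hsys := hnu.system _ hξ
  have hsys' := hsys.neg_conj
  simp only [map_mul, Complex.conj_ofReal, Complex.conj_I, mul_neg, neg_neg] at hsys'
  have hsymm := congrFun (nuSystem_unique (m := fun j => -starRingEnd ℂ (P.nuStar lam j)) h₁ h₂ h₃
    hξ hmem (fun j => by simpa using hmem j) hsys hsys') j
  have hre := congrArg Complex.re hsymm
  rw [Complex.neg_re, Complex.conj_re] at hre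
  apply Complex.ext
  · rw [Complex.re_ofReal_mul, Complex.I_re, mul_zero]
    linarith
  · rw [Complex.im_ofReal_mul, Complex.I_im, mul_one]

end NuSystem

end DRFMParams

section NodeSystem

variable {ι : Type*} [Fintype ι] {a c ψ p p' : ι → ℝ} {k k' ψ₃ lam t₃ : ℝ}

/-- The denominator `D = 1 + ∑ aᵢ pᵢ` of the `ν`-system, in the variables `pᵢ = -νᵢ ν₃`. -/
def den (a p : ι → ℝ) : ℝ := 1 + a ⬝ᵥ p

/-- The left-hand sides of the equations of `NodeSystem`. -/
noncomputable def nodeMap (a c : ι → ℝ) (k : ℝ) (p : ι → ℝ) (i : ι) : ℝ :=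
  k * p i + c i * p i + a i * p i / den a p

/-- The equations of the `ν`-system other than the last one, in the variables `pᵢ = -νᵢ ν₃` and
`k = √λ / |ν₃|`. In contrast to `ν`, these variables have limits as `λ → 0⁺`, which solve the same
equations. -/
structure NodeSystem (a c ψ : ι → ℝ) (k : ℝ) (p : ι → ℝ) : Prop where
  k_nonneg : 0 ≤ k
  p_nonneg : 0 ≤ p
  eq : nodeMap a c k p = ψ

/-- The whole `ν`-system, with `t₃ = √λ |ν₃|` in addition to the variables of `NodeSystem`. -/
structure RidgeSystem (a c ψ : ι → ℝ) (ψ₃ lam k t₃ : ℝ) (p : ι → ℝ) : Prop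
    extends NodeSystem a c ψ k p where
  t₃_pos : 0 < t₃
  eq₃ : t₃ + c ⬝ᵥ p + a ⬝ᵥ p / den a p = ψ₃
  mul : k * t₃ = lam

lemma one_le_den (ha : 0 ≤ a) (hp : 0 ≤ p) : 1 ≤ den a p :=
  le_add_of_nonneg_right (dotProduct_nonneg_of_nonneg ha hp)

lemma den_pos (ha : 0 ≤ a) (hp : 0 ≤ p) : 0 < den a p :=
  one_pos.trans_le (one_le_den ha hp)

lemma continuous_den (a : ι → ℝ) : Continuous (den a) := by
  unfold den
  fun_prop

namespace NodeSystem

lemma apply_eq (h : NodeSystem a c ψ k p) (i : ι) :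
    k * p i + c i * p i + a i * p i / den a p = ψ i :=
  congrFun h.eq i

lemma div_den_nonneg (h : NodeSystem a c ψ k p) (ha : 0 ≤ a) (i : ι) :
    0 ≤ a i * p i / den a p :=
  div_nonneg (mul_nonneg (ha i) (h.p_nonneg i)) (den_pos ha h.p_nonneg).le

lemma c_mul_le (h : NodeSystem a c ψ k p) (ha : 0 ≤ a) (i : ι) : c i * p i ≤ ψ i := by
  linarith [h.apply_eq i, h.div_den_nonneg ha i, mul_nonneg h.k_nonneg (h.p_nonneg i)]

lemma le_div (h : NodeSystem a c ψ k p) (ha : 0 ≤ a) (hc : ∀ i, 0 < c i) (i : ι) :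
    p i ≤ ψ i / c i := by
  rw [le_div_iff₀ (hc i), mul_comm]
  exact h.c_mul_le ha i

lemma k_mul_le (h : NodeSystem a c ψ k p) (ha : 0 ≤ a) (hc : 0 ≤ c) (i : ι) : k * p i ≤ ψ i := by
  linarith [h.apply_eq i, h.div_den_nonneg ha i, mul_nonneg (hc i) (h.p_nonneg i)]

lemma le_mul (h : NodeSystem a c ψ k p) (ha : 0 ≤ a) (i : ι) : ψ i ≤ p i * (k + c i + a i) := by
  have hdiv : a i * p i / den a p ≤ a i * p i :=
    div_le_self (mul_nonneg (ha i) (h.p_nonneg i)) (one_le_den ha h.p_nonneg)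
  linarith [h.apply_eq i]

lemma p_pos (h : NodeSystem a c ψ k p) (ha : 0 ≤ a) {i : ι} (hψ : 0 < ψ i) : 0 < p i := by
  refine (h.p_nonneg i).lt_of_ne fun h0 => ?_
  have hle := h.le_mul ha i
  rw [← h0, Pi.zero_apply, zero_mul] at hle
  exact hle.not_gt hψ

lemma p_eq (h : NodeSystem a c ψ k p) (ha : 0 ≤ a) (hc : ∀ i, 0 < c i) (i : ι) :
    p i = ψ i * den a p / (c i * den a p + k * den a p + a i) := by
  have hD := den_pos ha h.p_nonneg
  have hci := hc i
  have hk := h.k_nonneg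
  have hai : 0 ≤ a i := ha i
  rw [← h.apply_eq i]
  field_simp
  ring

lemma inv_den_add_sum (h : NodeSystem a c ψ k p) (ha : 0 ≤ a) (hc : ∀ i, 0 < c i) :
    (den a p)⁻¹ + ∑ i, a i * ψ i / (c i * den a p + k * den a p + a i) = 1 := by
  have hD := den_pos ha h.p_nonneg
  refine (mul_eq_left₀ hD.ne').1 ?_
  calc den a p * ((den a p)⁻¹ + ∑ i, a i * ψ i / (c i * den a p + k * den a p + a i))
      = 1 + ∑ i, a i * (ψ i * den a p / (c i * den a p + k * den a p + a i)) := by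
        rw [mul_add, mul_inv_cancel₀ hD.ne', Finset.mul_sum]
        congr! 2
        ring
    _ = den a p := by simp_rw [← h.p_eq ha hc, den, dotProduct]

/- `inv_den_add_sum` is an equation for `D` and `k D` whose left-hand side is strictly antitone in
`D` and antitone in `k D`. -/
lemma den_le_den (h : NodeSystem a c ψ k p) (h' : NodeSystem a c ψ k' p') (ha : 0 ≤ a)
    (hc : ∀ i, 0 < c i) (hψ : 0 ≤ ψ) (hk : k' * den a p' ≤ k * den a p) : den a p ≤ den a p' := by
  by_contra! hlt
  have hD' := den_pos ha h'.p_nonneg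
  have hinv : (den a p)⁻¹ < (den a p')⁻¹ := inv_strictAnti₀ hD' hlt
  have hsum : ∑ i, a i * ψ i / (c i * den a p + k * den a p + a i) ≤
      ∑ i, a i * ψ i / (c i * den a p' + k' * den a p' + a i) := by
    refine Finset.sum_le_sum fun i _ => ?_
    have hci := hc i
    have hk' := h'.k_nonneg
    have hai : 0 ≤ a i := ha i
    have hψi : 0 ≤ ψ i := hψ i
    gcongr
  linarith [h.inv_den_add_sum ha hc, h'.inv_den_add_sum ha hc]

lemma unique (h : NodeSystem a c ψ k p) (h' : NodeSystem a c ψ k p') (ha : 0 ≤ a)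
    (hc : ∀ i, 0 < c i) (hψ : 0 ≤ ψ) : p = p' := by
  have hD : den a p = den a p' := by
    rcases le_total (den a p) (den a p') with hle | hle
    · exact hle.antisymm
        (h'.den_le_den h ha hc hψ (mul_le_mul_of_nonneg_left hle h.k_nonneg))
    · exact (h.den_le_den h' ha hc hψ (mul_le_mul_of_nonneg_left hle h.k_nonneg)).antisymm hle
  funext i
  rw [h.p_eq ha hc, h'.p_eq ha hc, hD]

lemma k_mul_lt (h : NodeSystem a c ψ k p) (h' : NodeSystem a c ψ k' p') (ha : 0 ≤ a)
    (hc : ∀ i, 0 < c i) (hψ : ∀ i, 0 < ψ i) (hk : k < k') (i : ι) : k * p i < k' * p' i := by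
  have hD := den_pos ha h.p_nonneg
  have hD' := den_pos ha h'.p_nonneg
  have hk0 := h.k_nonneg
  have hk0' := hk0.trans_lt hk
  have hci := hc i
  have hψi := hψ i
  have hai : 0 ≤ a i := ha i
  have hkD : k * den a p ≤ k' * den a p' := by
    by_contra! hlt
    exact hlt.not_ge (mul_le_mul hk.le (h.den_le_den h' ha hc (fun i => (hψ i).le) hlt.le) hD.le
      hk0'.le)
  rw [h.p_eq ha hc, h'.p_eq ha hc, ← mul_div_assoc, ← mul_div_assoc,
    div_lt_div_iff₀ (by positivity) (by positivity)]
  have hc_term : ψ i * c i * den a p * den a p' * k < ψ i * c i * den a p * den a p' * k' := by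
    gcongr
  have ha_term : ψ i * a i * (k * den a p) ≤ ψ i * a i * (k' * den a p') := by gcongr
  linarith

lemma unique_of_k_mul_sum_eq [Nonempty ι] (h : NodeSystem a c ψ k p) (h' : NodeSystem a c ψ k' p')
    (ha : 0 ≤ a) (hc : ∀ i, 0 < c i) (hψ : ∀ i, 0 < ψ i) (hk : k * ∑ i, p i = k' * ∑ i, p' i) :
    k = k' ∧ p = p' := by
  have hkk : k = k' := by
    rw [Finset.mul_sum, Finset.mul_sum] at hk
    rcases lt_trichotomy k k' with hlt | heq | hgt
    · exact absurd hk (Finset.sum_lt_sum_of_nonempty Finset.univ_nonempty fun i _ =>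
        h.k_mul_lt h' ha hc hψ hlt i).ne
    · exact heq
    · exact absurd hk (Finset.sum_lt_sum_of_nonempty Finset.univ_nonempty fun i _ =>
        h'.k_mul_lt h ha hc hψ hgt i).ne'
  subst hkk
  exact ⟨rfl, h.unique h' ha hc fun i => (hψ i).le⟩

end NodeSystem

namespace RidgeSystem

lemma k_mul_sum (h : RidgeSystem a c ψ ψ₃ lam k t₃ p) :
    k * ∑ i, p i = ∑ i, ψ i - ψ₃ + t₃ := by
  rw [← h.eq₃]
  simp_rw [← h.apply_eq, Finset.sum_add_distrib, ← Finset.mul_sum, ← Finset.sum_div, dotProduct]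
  ring

lemma sq_sub_max_le (h : RidgeSystem a c ψ ψ₃ lam k t₃ p) (ha : 0 ≤ a) (hc : ∀ i, 0 < c i) :
    (t₃ - max (ψ₃ - ∑ i, ψ i) 0) ^ 2 ≤ lam * ∑ i, ψ i / c i := by
  have hT := h.k_mul_sum
  have ht₃ := h.t₃_pos
  have hT0 : 0 ≤ k * ∑ i, p i :=
    mul_nonneg h.k_nonneg (Finset.sum_nonneg fun i _ => h.p_nonneg i)
  calc (t₃ - max (ψ₃ - ∑ i, ψ i) 0) ^ 2 ≤ t₃ * (k * ∑ i, p i) := by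
        rcases max_cases (ψ₃ - ∑ i, ψ i) 0 with ⟨hmax, hle⟩ | ⟨hmax, hle⟩ <;> rw [hmax] <;>
          nlinarith
    _ = lam * ∑ i, p i := by rw [← h.mul]; ring
    _ ≤ lam * ∑ i, ψ i / c i := by
        have hlam : 0 ≤ lam := h.mul ▸ mul_nonneg h.k_nonneg ht₃.le
        gcongr with i
        exact h.le_div ha hc i

lemma k_mul_sub_le (h : RidgeSystem a c ψ ψ₃ lam k t₃ p) (ha : 0 ≤ a) (hc : 0 ≤ c) :
    k * (ψ₃ - t₃) ≤ (∑ i, (c i + a i)) * ∑ i, ψ i := by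
  have hsum : ∑ i, ψ i ≤ k * ∑ i, p i + ∑ i, (c i + a i) * p i := by
    rw [Finset.mul_sum, ← Finset.sum_add_distrib]
    exact Finset.sum_le_sum fun i _ => (h.le_mul ha i).trans_eq (by ring)
  have hk := h.k_nonneg
  calc k * (ψ₃ - t₃) ≤ k * ∑ i, (c i + a i) * p i := by
        gcongr
        linarith [h.k_mul_sum]
    _ = ∑ i, (c i + a i) * (k * p i) := by
        rw [Finset.mul_sum]
        exact Finset.sum_congr rfl fun i _ => by ring
    _ ≤ ∑ i, (c i + a i) * ∑ j, ψ j := by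
        refine Finset.sum_le_sum fun i _ => mul_le_mul_of_nonneg_left ?_ (add_nonneg (hc i) (ha i))
        exact (h.k_mul_le ha hc i).trans (Finset.single_le_sum (fun j _ =>
          (mul_nonneg hk (h.p_nonneg j)).trans (h.k_mul_le ha hc j)) (Finset.mem_univ i))
    _ = _ := (Finset.sum_mul ..).symm

end RidgeSystem

lemma exists_tendsto_of_isCompact {α X Y : Type*} [TopologicalSpace X] [TopologicalSpace Y]
    [T2Space Y] {l : Filter α} [l.NeBot] {K : Set X} (hK : IsCompact K) {g : X → Y}
    (hg : ∀ y ∈ K, ContinuousAt g y) {u : α → X} (hu : ∀ᶠ i in l, u i ∈ K) {z : Y}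
    (hz : Tendsto (fun i => g (u i)) l (𝓝 z))
    (huniq : ∀ y ∈ K, ∀ y' ∈ K, g y = z → g y' = z → y = y') :
    ∃ y ∈ K, g y = z ∧ Tendsto u l (𝓝 y) := by
  have hval (y) (hy : y ∈ K) (hcluster : MapClusterPt y l u) : g y = z :=
    eq_of_nhds_neBot (ClusterPt.mono (hcluster.continuousAt_comp (hg y hy)) hz)
  obtain ⟨y, hy, hcluster⟩ := hK.exists_mapClusterPt_of_frequently hu.frequently
  exact ⟨y, hy, hval y hy hcluster, hK.tendsto_nhds_of_unique_mapClusterPt hu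
    fun y' hy' hcluster' => huniq _ hy' _ hy (hval _ hy' hcluster') (hval _ hy hcluster)⟩

lemma continuousAt_nodeMap {v : ℝ × (ι → ℝ)} (hv : den a v.2 ≠ 0) :
    ContinuousAt (fun v : ℝ × (ι → ℝ) => (nodeMap a c v.1 v.2, v.1 * ∑ i, v.2 i)) v := by
  have hden : ContinuousAt (fun v : ℝ × (ι → ℝ) => den a v.2) v :=
    ((continuous_den a).comp continuous_snd).continuousAt
  refine ContinuousAt.prodMk (continuousAt_pi.2 fun i => ?_) (by fun_prop)
  unfold nodeMap
  fun_prop (disch := assumption)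

end NodeSystem

section RidgelessLimit

variable {ι α : Type*} [Fintype ι] {a c ψ : ι → ℝ} {ψ₃ : ℝ} {l : Filter α} {lam k t₃ : α → ℝ}
  {p : α → ι → ℝ}

lemma RidgeSystem.tendsto_t₃ (ha : 0 ≤ a) (hc : ∀ i, 0 < c i) (hlam : Tendsto lam l (𝓝 0))
    (h : ∀ᶠ x in l, RidgeSystem a c ψ ψ₃ (lam x) (k x) (t₃ x) (p x)) :
    Tendsto t₃ l (𝓝 (max (ψ₃ - ∑ i, ψ i) 0)) := by
  have hsqrt : Tendsto (fun x => √(lam x * ∑ i, ψ i / c i)) l (𝓝 0) := by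
    simpa using (hlam.mul_const (∑ i, ψ i / c i)).sqrt
  refine tendsto_sub_nhds_zero_iff.1 (squeeze_zero_norm' (h.mono fun x hx => ?_) hsqrt)
  exact Real.abs_le_sqrt (hx.sq_sub_max_le ha hc)

lemma RidgeSystem.exists_eventually_k_le (ha : 0 ≤ a) (hc : ∀ i, 0 < c i) (hψ₃ : 0 < ψ₃)
    (hψ : 0 < ∑ i, ψ i) (hlam : Tendsto lam l (𝓝 0))
    (h : ∀ᶠ x in l, RidgeSystem a c ψ ψ₃ (lam x) (k x) (t₃ x) (p x)) :
    ∃ K, ∀ᶠ x in l, k x ≤ K := by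
  have hgap : 0 < ψ₃ - max (ψ₃ - ∑ i, ψ i) 0 := sub_pos.2 (max_lt (by linarith) hψ₃)
  have ht₃ := (RidgeSystem.tendsto_t₃ ha hc hlam h).const_sub ψ₃
  refine ⟨(∑ i, (c i + a i)) * ∑ i, ψ i / ((ψ₃ - max (ψ₃ - ∑ i, ψ i) 0) / 2), ?_⟩
  filter_upwards [h, ht₃.eventually (lt_mem_nhds (half_lt_self hgap))] with x hx hlt
  rw [← Finset.sum_div, ← mul_div_assoc, le_div_iff₀ (half_pos hgap)]
  exact (mul_le_mul_of_nonneg_left hlt.le hx.k_nonneg).trans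
    (hx.k_mul_sub_le ha fun i => (hc i).le)

theorem RidgeSystem.exists_tendsto [Nonempty ι] [l.NeBot] (ha : 0 ≤ a) (hc : ∀ i, 0 < c i)
    (hψ : ∀ i, 0 < ψ i) (hψ₃ : 0 < ψ₃) (hlam : Tendsto lam l (𝓝 0))
    (h : ∀ᶠ x in l, RidgeSystem a c ψ ψ₃ (lam x) (k x) (t₃ x) (p x)) :
    ∃ k₀ p₀, NodeSystem a c ψ k₀ p₀ ∧ k₀ * ∑ i, p₀ i = max (∑ i, ψ i - ψ₃) 0 ∧
      Tendsto k l (𝓝 k₀) ∧ Tendsto p l (𝓝 p₀) := by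
  have hψsum : 0 < ∑ i, ψ i := Finset.sum_pos (fun i _ => hψ i) Finset.univ_nonempty
  obtain ⟨K, hK⟩ := RidgeSystem.exists_eventually_k_le ha hc hψ₃ hψsum hlam h
  have hcompact : IsCompact (Set.Icc 0 K ×ˢ Set.Icc 0 fun i => ψ i / c i) :=
    isCompact_Icc.prod isCompact_Icc
  have hmem : ∀ᶠ x in l, (k x, p x) ∈ Set.Icc 0 K ×ˢ Set.Icc 0 fun i => ψ i / c i := by
    filter_upwards [h, hK] with x hx hkx
    exact ⟨⟨hx.k_nonneg, hkx⟩, hx.p_nonneg, fun i => hx.le_div ha hc i⟩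
  have hlim : Tendsto (fun x => (nodeMap a c (k x) (p x), k x * ∑ i, p x i)) l
      (𝓝 (ψ, max (∑ i, ψ i - ψ₃) 0)) := by
    have htotal : ∑ i, ψ i - ψ₃ + max (ψ₃ - ∑ i, ψ i) 0 = max (∑ i, ψ i - ψ₃) 0 := by
      rw [← max_add_add_left, max_comm]
      simp
    rw [← htotal]
    exact (tendsto_const_nhds.prodMk_nhds
      ((RidgeSystem.tendsto_t₃ ha hc hlam h).const_add _)).congr'
      (h.mono fun x hx => by simp only [hx.eq, hx.k_mul_sum])
  have hnode (v : ℝ × (ι → ℝ)) (hv : v ∈ Set.Icc 0 K ×ˢ Set.Icc 0 fun i => ψ i / c i)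
      (heq : (nodeMap a c v.1 v.2, v.1 * ∑ i, v.2 i) = (ψ, max (∑ i, ψ i - ψ₃) 0)) :
      NodeSystem a c ψ v.1 v.2 ∧ v.1 * ∑ i, v.2 i = max (∑ i, ψ i - ψ₃) 0 :=
    ⟨⟨hv.1.1, hv.2.1, congrArg Prod.fst heq⟩, congrArg Prod.snd heq⟩
  obtain ⟨v, hv, heq, htendsto⟩ := exists_tendsto_of_isCompact hcompact
    (fun v hv => continuousAt_nodeMap (den_pos ha hv.2.1).ne') hmem hlim
    fun v hv w hw heqv heqw => by
      obtain ⟨hnodev, hsumv⟩ := hnode v hv heqv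
      obtain ⟨hnodew, hsumw⟩ := hnode w hw heqw
      exact Prod.ext_iff.2 (hnodev.unique_of_k_mul_sum_eq hnodew ha hc hψ (hsumv.trans hsumw.symm))
  obtain ⟨hnodev, hsumv⟩ := hnode v hv heq
  exact ⟨v.1, v.2, hnodev, hsumv, htendsto.fst_nhds, htendsto.snd_nhds⟩

end RidgelessLimit

section GroundedLaplacian

/-- The Laplacian of the triangle with vertices `0, 1, 2` and edge weights `v = {0, 1}` and
`w i = {i, 2}`, whose vertices are connected to the ground with weights `t 0`, `t 1` and `t₃`. -/
def groundedLaplacian (t w : Fin 2 → ℝ) (t₃ v : ℝ) : Matrix (Fin 3) (Fin 3) ℝ :=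
  !![t 0 + v + w 0, -v, -w 0;
     -v, t 1 + v + w 1, -w 1;
     -w 0, -w 1, t₃ + w 0 + w 1]

variable {t w : Fin 2 → ℝ} {t₃ v : ℝ}

lemma det_groundedLaplacian (t w : Fin 2 → ℝ) (t₃ v : ℝ) :
    (groundedLaplacian t w t₃ v).det =
      t 0 * t 1 * t₃ + t 0 * t 1 * (w 0 + w 1) + t 0 * t₃ * (v + w 1) + t 1 * t₃ * (v + w 0) +
        (t 0 + t 1 + t₃) * (v * w 0 + v * w 1 + w 0 * w 1) := by
  simp only [groundedLaplacian, Matrix.det_fin_three, Matrix.of_apply, Matrix.cons_val]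
  ring

lemma adjugate_groundedLaplacian (t w : Fin 2 → ℝ) (t₃ v : ℝ) :
    (groundedLaplacian t w t₃ v).adjugate =
      !![t 1 * t₃ + t 1 * (w 0 + w 1) + t₃ * (v + w 1) + (v * w 0 + v * w 1 + w 0 * w 1),
          v * t₃ + (v * w 0 + v * w 1 + w 0 * w 1),
          w 0 * t 1 + (v * w 0 + v * w 1 + w 0 * w 1);
        v * t₃ + (v * w 0 + v * w 1 + w 0 * w 1),
          t 0 * t₃ + t 0 * (w 0 + w 1) + t₃ * (v + w 0) + (v * w 0 + v * w 1 + w 0 * w 1),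
          w 1 * t 0 + (v * w 0 + v * w 1 + w 0 * w 1);
        w 0 * t 1 + (v * w 0 + v * w 1 + w 0 * w 1),
          w 1 * t 0 + (v * w 0 + v * w 1 + w 0 * w 1),
          t 0 * t 1 + t 0 * (v + w 1) + t 1 * (v + w 0) + (v * w 0 + v * w 1 + w 0 * w 1)] := by
  rw [groundedLaplacian, Matrix.adjugate_fin_three_of]
  ext i j
  fin_cases i <;> fin_cases j <;> simp only [Matrix.of_apply, Matrix.cons_val', Matrix.cons_val,
    Matrix.cons_val_zero, Matrix.cons_val_one, Matrix.cons_val_fin_one, Fin.zero_eta, Fin.mk_one,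
    Fin.reduceFinMk] <;> ring

lemma det_groundedLaplacian_pos (ht : 0 ≤ t) (ht₃ : 0 ≤ t₃) (hpos : 0 < t 0 + t 1 + t₃)
    (hw : ∀ i, 0 < w i) (hv : 0 ≤ v) : 0 < (groundedLaplacian t w t₃ v).det := by
  have h₀ : 0 ≤ t 0 := ht 0
  have h₁ : 0 ≤ t 1 := ht 1
  have hw₀ := hw 0
  have hw₁ := hw 1
  rw [det_groundedLaplacian]
  positivity

lemma adjugate_groundedLaplacian_nonneg (ht : 0 ≤ t) (ht₃ : 0 ≤ t₃) (hw : 0 ≤ w) (hv : 0 ≤ v)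
    (i j : Fin 3) : 0 ≤ (groundedLaplacian t w t₃ v).adjugate i j := by
  have h₀ : 0 ≤ t 0 := ht 0
  have h₁ : 0 ≤ t 1 := ht 1
  have hw₀ : 0 ≤ w 0 := hw 0
  have hw₁ : 0 ≤ w 1 := hw 1
  rw [adjugate_groundedLaplacian]
  fin_cases i <;> fin_cases j <;> simp only [Matrix.of_apply, Matrix.cons_val', Matrix.cons_val,
    Matrix.cons_val_zero, Matrix.cons_val_one, Matrix.cons_val_fin_one, Fin.zero_eta, Fin.mk_one,
    Fin.reduceFinMk] <;>
    positivity

end GroundedLaplacian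

section ReducedRisk

variable {a c ψ p : Fin 2 → ℝ} {F τ k t₃ ψ₃ lam : ℝ}

/-- The matrix `H` of the paper in the variables of `RidgeSystem`, up to multiplication by a
diagonal matrix on both sides. -/
noncomputable def nodeLaplacian (a c : Fin 2 → ℝ) (k t₃ : ℝ) (p : Fin 2 → ℝ) :
    Matrix (Fin 3) (Fin 3) ℝ :=
  groundedLaplacian (k • p) (fun i => c i * p i + a i * p i / den a p ^ 2) t₃
    (a 0 * p 0 * (a 1 * p 1) / den a p ^ 2)

/-- The matrix `V` of the paper in the variables of `RidgeSystem`, up to multiplication by a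
diagonal matrix on both sides. -/
noncomputable def loadMatrix (a c p : Fin 2 → ℝ) : Matrix (Fin 3) (Fin 4) ℝ :=
  !![c 0 * p 0, 0, a 0 * p 0 / den a p ^ 2, a 0 * p 0 / den a p ^ 2;
     c 1 * p 1, 0, a 1 * p 1 / den a p ^ 2, a 1 * p 1 / den a p ^ 2;
     0, 1, (a ⬝ᵥ p) ^ 2 / den a p ^ 2, 1 / den a p ^ 2]

/-- The matrix `L = Vᵀ H⁻¹ V` of the paper in the variables of `RidgeSystem`, up to multiplication
by a diagonal matrix on both sides. -/
noncomputable def loadResponse (a c : Fin 2 → ℝ) (k t₃ : ℝ) (p : Fin 2 → ℝ) :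
    Matrix (Fin 4) (Fin 4) ℝ :=
  (loadMatrix a c p).transpose * (nodeLaplacian a c k t₃ p)⁻¹ * loadMatrix a c p

/-- The excess risk in the variables of `RidgeSystem`. -/
noncomputable def reducedRisk (a c : Fin 2 → ℝ) (F τ k t₃ : ℝ) (p : Fin 2 → ℝ) : ℝ :=
  F ^ 2 * (1 / den a p ^ 2 + loadResponse a c k t₃ p 2 3 + loadResponse a c k t₃ p 0 3) +
    τ ^ 2 * (loadResponse a c k t₃ p 1 2 + loadResponse a c k t₃ p 0 1)

lemma NodeSystem.det_nodeLaplacian_pos (h : NodeSystem a c ψ k p) (ha : 0 ≤ a)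
    (hc : ∀ i, 0 < c i) (hψ : ∀ i, 0 < ψ i) (ht₃ : 0 ≤ t₃) (hpos : 0 < k * ∑ i, p i + t₃) :
    0 < (nodeLaplacian a c k t₃ p).det := by
  have hap (i) : 0 ≤ a i * p i := mul_nonneg (ha i) (h.p_nonneg i)
  refine det_groundedLaplacian_pos (smul_nonneg h.k_nonneg h.p_nonneg) ht₃ ?_ (fun i => ?_) ?_
  · simpa [Fin.sum_univ_two, mul_add] using hpos
  · exact add_pos_of_pos_of_nonneg (mul_pos (hc i) (h.p_pos ha (hψ i)))
      (div_nonneg (hap i) (sq_nonneg _))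
  · exact div_nonneg (mul_nonneg (hap 0) (hap 1)) (sq_nonneg _)

lemma det_nodeLaplacian_zero_zero (a c p : Fin 2 → ℝ) : (nodeLaplacian a c 0 0 p).det = 0 := by
  simp [nodeLaplacian, det_groundedLaplacian]

lemma continuousAt_nodeLaplacian {u : ℝ × ℝ × (Fin 2 → ℝ)} (hD : den a u.2.2 ≠ 0) :
    ContinuousAt (fun u : ℝ × ℝ × (Fin 2 → ℝ) => nodeLaplacian a c u.1 u.2.1 u.2.2) u := by
  have hden : ContinuousAt (fun u : ℝ × ℝ × (Fin 2 → ℝ) => den a u.2.2) u :=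
    ((continuous_den a).comp (by fun_prop)).continuousAt
  have hD2 := pow_ne_zero 2 hD
  refine continuousAt_pi.2 fun i => continuousAt_pi.2 fun j => ?_
  simp only [nodeLaplacian, groundedLaplacian]
  fin_cases i <;> fin_cases j <;> simp only [Matrix.of_apply, Matrix.cons_val', Matrix.cons_val,
    Matrix.cons_val_zero, Matrix.cons_val_one, Matrix.cons_val_fin_one, Fin.zero_eta, Fin.mk_one,
    Fin.reduceFinMk, Pi.smul_apply, smul_eq_mul] <;>
    fun_prop (disch := assumption)

lemma continuousAt_loadMatrix {u : ℝ × ℝ × (Fin 2 → ℝ)} (hD : den a u.2.2 ≠ 0) :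
    ContinuousAt (fun u : ℝ × ℝ × (Fin 2 → ℝ) => loadMatrix a c u.2.2) u := by
  have hden : ContinuousAt (fun u : ℝ × ℝ × (Fin 2 → ℝ) => den a u.2.2) u :=
    ((continuous_den a).comp (by fun_prop)).continuousAt
  have hD2 := pow_ne_zero 2 hD
  refine continuousAt_pi.2 fun i => continuousAt_pi.2 fun j => ?_
  simp only [loadMatrix, dotProduct]
  fin_cases i <;> fin_cases j <;> simp only [Matrix.of_apply, Matrix.cons_val', Matrix.cons_val,
    Matrix.cons_val_zero, Matrix.cons_val_one, Matrix.cons_val_fin_one, Fin.zero_eta, Fin.mk_one,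
    Fin.reduceFinMk] <;>
    fun_prop (disch := assumption)

lemma continuousAt_reducedRisk {u : ℝ × ℝ × (Fin 2 → ℝ)} (hD : den a u.2.2 ≠ 0)
    (hdet : (nodeLaplacian a c u.1 u.2.1 u.2.2).det ≠ 0) :
    ContinuousAt (fun u : ℝ × ℝ × (Fin 2 → ℝ) => reducedRisk a c F τ u.1 u.2.1 u.2.2) u := by
  have hD2 := pow_ne_zero 2 hD
  have hden : ContinuousAt (fun u : ℝ × ℝ × (Fin 2 → ℝ) => den a u.2.2) u :=
    ((continuous_den a).comp (by fun_prop)).continuousAt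
  have hload (i j) : ContinuousAt (fun u : ℝ × ℝ × (Fin 2 → ℝ) => loadMatrix a c u.2.2 i j) u :=
    continuousAt_pi.1 (continuousAt_pi.1 (continuousAt_loadMatrix hD) i) j
  have hinv : ContinuousAt
      (fun u : ℝ × ℝ × (Fin 2 → ℝ) => (nodeLaplacian a c u.1 u.2.1 u.2.2)⁻¹) u :=
    (continuousAt_matrix_inv _ (by simpa using continuousAt_inv₀ hdet)).comp
      (continuousAt_nodeLaplacian hD)
  have hinv' (i j) := continuousAt_pi.1 (continuousAt_pi.1 hinv i) j
  have hL (i j) : ContinuousAt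
      (fun u : ℝ × ℝ × (Fin 2 → ℝ) => loadResponse a c u.1 u.2.1 u.2.2 i j) u := by
    simp only [loadResponse, Matrix.mul_apply, Matrix.transpose_apply]
    fun_prop
  unfold reducedRisk
  fun_prop (disch := assumption)

lemma inv_nodeLaplacian_nonneg (ha : 0 ≤ a) (hc : 0 ≤ c) (hp : 0 ≤ p) (hk : 0 ≤ k) (ht₃ : 0 ≤ t₃)
    (hdet : 0 < (nodeLaplacian a c k t₃ p).det) (i j : Fin 3) :
    0 ≤ (nodeLaplacian a c k t₃ p)⁻¹ i j := by
  have hap (i) : 0 ≤ a i * p i := mul_nonneg (ha i) (hp i)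
  have hw (i) : 0 ≤ c i * p i + a i * p i / den a p ^ 2 :=
    add_nonneg (mul_nonneg (hc i) (hp i)) (div_nonneg (hap i) (sq_nonneg _))
  rw [Matrix.inv_def, Ring.inverse_eq_inv', Matrix.smul_apply, smul_eq_mul]
  exact mul_nonneg (inv_nonneg.2 hdet.le) (adjugate_groundedLaplacian_nonneg (smul_nonneg hk hp)
    ht₃ hw (div_nonneg (mul_nonneg (hap 0) (hap 1)) (sq_nonneg _)) i j)

lemma loadMatrix_nonneg (ha : 0 ≤ a) (hc : 0 ≤ c) (hp : 0 ≤ p) (i : Fin 3) (j : Fin 4) :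
    0 ≤ loadMatrix a c p i j := by
  have hap (i) : 0 ≤ a i * p i := mul_nonneg (ha i) (hp i)
  have hcp (i) : 0 ≤ c i * p i := mul_nonneg (hc i) (hp i)
  have hap₀ := hap 0
  have hap₁ := hap 1
  have hcp₀ := hcp 0
  have hcp₁ := hcp 1
  rw [loadMatrix]
  fin_cases i <;> fin_cases j <;> simp only [Matrix.of_apply, Matrix.cons_val', Matrix.cons_val,
    Matrix.cons_val_zero, Matrix.cons_val_one, Matrix.cons_val_fin_one, Fin.zero_eta, Fin.mk_one,
    Fin.reduceFinMk] <;>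
    positivity

lemma mul_inv_mul_le_loadResponse (ha : 0 ≤ a) (hc : 0 ≤ c) (hp : 0 ≤ p) (hk : 0 ≤ k)
    (ht₃ : 0 ≤ t₃) (hdet : 0 < (nodeLaplacian a c k t₃ p).det) (m n : Fin 3) (i j : Fin 4) :
    loadMatrix a c p m i * (nodeLaplacian a c k t₃ p)⁻¹ m n * loadMatrix a c p n j ≤
      loadResponse a c k t₃ p i j := by
  have hU := loadMatrix_nonneg ha hc hp
  have hG := inv_nodeLaplacian_nonneg ha hc hp hk ht₃ hdet
  simp only [loadResponse, Matrix.mul_apply, Matrix.transpose_apply]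
  refine le_trans ?_ (Finset.single_le_sum (fun n' _ => mul_nonneg (Finset.sum_nonneg fun m' _ =>
    mul_nonneg (hU m' i) (hG m' n')) (hU n' j)) (Finset.mem_univ n))
  exact mul_le_mul_of_nonneg_right (Finset.single_le_sum (fun m' _ =>
    mul_nonneg (hU m' i) (hG m' n)) (Finset.mem_univ m)) (hU n j)

lemma loadResponse_nonneg (ha : 0 ≤ a) (hc : 0 ≤ c) (hp : 0 ≤ p) (hk : 0 ≤ k)
    (ht₃ : 0 ≤ t₃) (hdet : 0 < (nodeLaplacian a c k t₃ p).det) (i j : Fin 4) :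
    0 ≤ loadResponse a c k t₃ p i j :=
  (mul_nonneg (mul_nonneg (loadMatrix_nonneg ha hc hp 0 i)
    (inv_nodeLaplacian_nonneg ha hc hp hk ht₃ hdet 0 0)) (loadMatrix_nonneg ha hc hp 0 j)).trans
    (mul_inv_mul_le_loadResponse ha hc hp hk ht₃ hdet 0 0 i j)

lemma NodeSystem.mul_le_adjugate_nodeLaplacian (h : NodeSystem a c ψ k p) (ha : 0 ≤ a)
    (hc : 0 ≤ c) :
    c 0 * p 0 * (ψ 1 / den a p) ≤ (nodeLaplacian a c k t₃ p).adjugate 0 2 := by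
  have hD := den_pos ha h.p_nonneg
  have hD1 := one_le_den ha h.p_nonneg
  have hap (i) : 0 ≤ a i * p i := mul_nonneg (ha i) (h.p_nonneg i)
  have hcp (i) : 0 ≤ c i * p i := mul_nonneg (hc i) (h.p_nonneg i)
  have hkp (i) : 0 ≤ k * p i := mul_nonneg h.k_nonneg (h.p_nonneg i)
  have hψ : ψ 1 / den a p ≤ k * p 1 + (c 1 * p 1 + a 1 * p 1 / den a p ^ 2) := by
    rw [← h.apply_eq 1, add_assoc, add_div, add_div, div_div, ← pow_two]
    gcongr
    · exact div_le_self (hkp 1) hD1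
    · exact div_le_self (hcp 1) hD1
  have hw (i) : 0 ≤ c i * p i + a i * p i / den a p ^ 2 :=
    add_nonneg (hcp i) (div_nonneg (hap i) (sq_nonneg _))
  have hv : 0 ≤ a 0 * p 0 * (a 1 * p 1) / den a p ^ 2 :=
    div_nonneg (mul_nonneg (hap 0) (hap 1)) (sq_nonneg _)
  calc c 0 * p 0 * (ψ 1 / den a p)
      ≤ (c 0 * p 0 + a 0 * p 0 / den a p ^ 2) *
          (k * p 1 + (c 1 * p 1 + a 1 * p 1 / den a p ^ 2)) :=
        mul_le_mul (le_add_of_nonneg_right (div_nonneg (hap 0) (sq_nonneg _))) hψ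
          (div_nonneg ((hcp 1).trans (h.c_mul_le ha 1)) hD.le) (hw 0)
    _ ≤ (nodeLaplacian a c k t₃ p).adjugate 0 2 := by
        rw [nodeLaplacian, adjugate_groundedLaplacian]
        simp only [Matrix.of_apply, Matrix.cons_val, Pi.smul_apply, smul_eq_mul]
        linarith [mul_nonneg hv (hw 0), mul_nonneg hv (hw 1)]

/- The bound is the contribution of `V₁₁ (H⁻¹)₁₃ V₃₄` to `L₁₄`. -/
lemma NodeSystem.div_det_le_reducedRisk (h : NodeSystem a c ψ k p) (ha : 0 ≤ a) (hc : 0 ≤ c)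
    (ht₃ : 0 ≤ t₃) (hdet : 0 < (nodeLaplacian a c k t₃ p).det) :
    F ^ 2 * ((c 0 * p 0) ^ 2 * ψ 1 / den a p ^ 3) / (nodeLaplacian a c k t₃ p).det ≤
      reducedRisk a c F τ k t₃ p := by
  have hD := den_pos ha h.p_nonneg
  have hL := loadResponse_nonneg ha hc h.p_nonneg h.k_nonneg ht₃ hdet
  have hcp : 0 ≤ c 0 * p 0 := mul_nonneg (hc 0) (h.p_nonneg 0)
  have hle : (c 0 * p 0) ^ 2 * ψ 1 / den a p ^ 3 / (nodeLaplacian a c k t₃ p).det ≤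
      loadResponse a c k t₃ p 0 3 := by
    calc (c 0 * p 0) ^ 2 * ψ 1 / den a p ^ 3 / (nodeLaplacian a c k t₃ p).det
        = c 0 * p 0 * ((nodeLaplacian a c k t₃ p).det⁻¹ * (c 0 * p 0 * (ψ 1 / den a p))) *
          (1 / den a p ^ 2) := by field_simp
      _ ≤ c 0 * p 0 * ((nodeLaplacian a c k t₃ p).det⁻¹ *
          (nodeLaplacian a c k t₃ p).adjugate 0 2) * (1 / den a p ^ 2) := by
        gcongr
        exact h.mul_le_adjugate_nodeLaplacian ha hc
      _ = loadMatrix a c p 0 0 * (nodeLaplacian a c k t₃ p)⁻¹ 0 2 * loadMatrix a c p 2 3 := by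
        rw [Matrix.inv_def, Ring.inverse_eq_inv', Matrix.smul_apply, smul_eq_mul]
        rfl
      _ ≤ _ := mul_inv_mul_le_loadResponse ha hc h.p_nonneg h.k_nonneg ht₃ hdet 0 2 0 3
  rw [mul_div_assoc]
  refine (mul_le_mul_of_nonneg_left (hle.trans ?_) (sq_nonneg F)).trans
    (le_add_of_nonneg_right (mul_nonneg (sq_nonneg τ) (add_nonneg (hL 1 2) (hL 0 1))))
  exact le_add_of_nonneg_left (add_nonneg (by positivity) (hL 2 3))

theorem tendsto_reducedRisk_atTop {α : Type*} {l : Filter α} {a c p : α → Fin 2 → ℝ}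
    {k t₃ : α → ℝ} {m M : ℝ} (hF : F ≠ 0) (hψ : 0 < ψ 1) (hm : 0 < m)
    (ha : ∀ᶠ x in l, 0 ≤ a x) (hc : ∀ᶠ x in l, 0 ≤ c x)
    (h : ∀ᶠ x in l, NodeSystem (a x) (c x) ψ (k x) (p x)) (ht₃ : ∀ᶠ x in l, 0 ≤ t₃ x)
    (hcp : ∀ᶠ x in l, m ≤ c x 0 * p x 0) (hden : ∀ᶠ x in l, den (a x) (p x) ≤ M)
    (hpos : ∀ᶠ x in l, 0 < (nodeLaplacian (a x) (c x) (k x) (t₃ x) (p x)).det)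
    (hdet : Tendsto (fun x => (nodeLaplacian (a x) (c x) (k x) (t₃ x) (p x)).det) l (𝓝 0)) :
    Tendsto (fun x => reducedRisk (a x) (c x) F τ (k x) (t₃ x) (p x)) l atTop := by
  rcases l.eq_or_neBot with rfl | hl
  · simp
  obtain ⟨x, hax, hx, hMx⟩ := (ha.and (h.and hden)).exists
  have hM : 0 < M := (den_pos hax hx.p_nonneg).trans_le hMx
  have hinv := tendsto_inv_nhdsGT_zero.comp (tendsto_nhdsWithin_iff.2 ⟨hdet, hpos⟩)
  refine tendsto_atTop_mono' l ?_
    (hinv.const_mul_atTop (show 0 < F ^ 2 * (m ^ 2 * ψ 1 / M ^ 3) by positivity))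
  filter_upwards [ha, hc, h, ht₃, hcp, hden, hpos] with x hax hcx hx ht₃x hmx hMx hdetx
  have hD := den_pos hax hx.p_nonneg
  refine le_trans ?_ (hx.div_det_le_reducedRisk hax hcx ht₃x hdetx)
  rw [Function.comp_apply, ← div_eq_mul_inv]
  gcongr

lemma RidgeSystem.nodeLaplacian_eq (h : RidgeSystem a c ψ ψ₃ lam k t₃ p) (ha : 0 ≤ a) :
    nodeLaplacian a c k t₃ p =
      !![ψ 0 - (a 0 * p 0 / den a p) ^ 2, -(a 0 * p 0 * (a 1 * p 1) / den a p ^ 2),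
          -(c 0 * p 0 + a 0 * p 0 / den a p ^ 2);
        -(a 0 * p 0 * (a 1 * p 1) / den a p ^ 2), ψ 1 - (a 1 * p 1 / den a p) ^ 2,
          -(c 1 * p 1 + a 1 * p 1 / den a p ^ 2);
        -(c 0 * p 0 + a 0 * p 0 / den a p ^ 2), -(c 1 * p 1 + a 1 * p 1 / den a p ^ 2),
          ψ₃ - (a ⬝ᵥ p / den a p) ^ 2] := by
  have hD : den a p ≠ 0 := (den_pos ha h.p_nonneg).ne'
  have hden : den a p = 1 + (a 0 * p 0 + a 1 * p 1) := by
    rw [den, dotProduct, Fin.sum_univ_two]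
  have hdiag₀ : k * p 0 + a 0 * p 0 * (a 1 * p 1) / den a p ^ 2 +
      (c 0 * p 0 + a 0 * p 0 / den a p ^ 2) = ψ 0 - (a 0 * p 0 / den a p) ^ 2 := by
    rw [← h.apply_eq 0]
    field_simp
    rw [hden]
    ring
  have hdiag₁ : k * p 1 + a 0 * p 0 * (a 1 * p 1) / den a p ^ 2 +
      (c 1 * p 1 + a 1 * p 1 / den a p ^ 2) = ψ 1 - (a 1 * p 1 / den a p) ^ 2 := by
    rw [← h.apply_eq 1]
    field_simp
    rw [hden]
    ring
  have hdiag₂ : t₃ + (c 0 * p 0 + a 0 * p 0 / den a p ^ 2) +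
      (c 1 * p 1 + a 1 * p 1 / den a p ^ 2) = ψ₃ - (a ⬝ᵥ p / den a p) ^ 2 := by
    rw [← h.eq₃, dotProduct, dotProduct, Fin.sum_univ_two, Fin.sum_univ_two]
    field_simp
    rw [hden]
    ring
  simp only [nodeLaplacian, groundedLaplacian, Pi.smul_apply, smul_eq_mul, hdiag₀, hdiag₁, hdiag₂]

lemma NodeSystem.weight_le (h : NodeSystem a c ψ k p) (ha : 0 ≤ a) (i : Fin 2) :
    c i * p i + a i * p i / den a p ^ 2 ≤ ψ i - k * p i := by
  have hle : a i * p i / den a p ^ 2 ≤ a i * p i / den a p := by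
    have hap : 0 ≤ a i * p i := mul_nonneg (ha i) (h.p_nonneg i)
    have hD := den_pos ha h.p_nonneg
    gcongr
    exact le_self_pow₀ (one_le_den ha h.p_nonneg) two_ne_zero
  linarith [h.apply_eq i]

lemma dotProduct_div_den_le_one (ha : 0 ≤ a) (hp : 0 ≤ p) : a ⬝ᵥ p / den a p ≤ 1 :=
  div_le_one_of_le₀ (le_add_of_nonneg_left zero_le_one) (den_pos ha hp).le

lemma NodeSystem.coupling_le (h : NodeSystem a c ψ k p) (ha : 0 ≤ a) (hc : 0 ≤ c) :
    a 0 * p 0 * (a 1 * p 1) / den a p ^ 2 ≤ ψ 1 - k * p 1 := by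
  have hap : a 0 * p 0 ≤ a ⬝ᵥ p := by
    rw [dotProduct, Fin.sum_univ_two]
    exact le_add_of_nonneg_right (mul_nonneg (ha 1) (h.p_nonneg 1))
  have hle : a 0 * p 0 / den a p ≤ 1 :=
    (div_le_div_of_nonneg_right hap (den_pos ha h.p_nonneg).le).trans
      (dotProduct_div_den_le_one ha h.p_nonneg)
  calc a 0 * p 0 * (a 1 * p 1) / den a p ^ 2
      = a 0 * p 0 / den a p * (a 1 * p 1 / den a p) := by rw [pow_two, mul_div_mul_comm]
    _ ≤ a 1 * p 1 / den a p := mul_le_of_le_one_left (h.div_den_nonneg ha 1) hle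
    _ ≤ ψ 1 - k * p 1 := by linarith [h.apply_eq 1, mul_nonneg (hc 1) (h.p_nonneg 1)]

lemma NodeSystem.abs_nodeLaplacian_le (h : NodeSystem a c ψ k p) (ha : 0 ≤ a) (hc : 0 ≤ c)
    (i j : Fin 3) : |nodeLaplacian a c k 0 p i j| ≤ 2 * (ψ 0 + ψ 1) := by
  have hap (i) : 0 ≤ a i * p i := mul_nonneg (ha i) (h.p_nonneg i)
  have hk (i) : 0 ≤ k * p i := mul_nonneg h.k_nonneg (h.p_nonneg i)
  have hw (i) : 0 ≤ c i * p i + a i * p i / den a p ^ 2 :=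
    add_nonneg (mul_nonneg (hc i) (h.p_nonneg i)) (div_nonneg (hap i) (sq_nonneg _))
  have hv : 0 ≤ a 0 * p 0 * (a 1 * p 1) / den a p ^ 2 :=
    div_nonneg (mul_nonneg (hap 0) (hap 1)) (sq_nonneg _)
  have hv_le := h.coupling_le ha hc
  have hw_le := h.weight_le ha
  rw [abs_le]
  simp only [nodeLaplacian, groundedLaplacian]
  fin_cases i <;> fin_cases j <;> simp only [Matrix.of_apply, Matrix.cons_val', Matrix.cons_val,
    Matrix.cons_val_zero, Matrix.cons_val_one, Matrix.cons_val_fin_one, Fin.zero_eta, Fin.mk_one,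
    Fin.reduceFinMk, Pi.smul_apply, smul_eq_mul] <;> constructor <;>
    linarith [hk 0, hk 1, hw 0, hw 1, hw_le 0, hw_le 1]

lemma inv_den_sq_le_one (ha : 0 ≤ a) (hp : 0 ≤ p) : (den a p ^ 2)⁻¹ ≤ 1 :=
  inv_le_one_of_one_le₀ (one_le_pow₀ (one_le_den ha hp))

lemma NodeSystem.loadMatrix_le (h : NodeSystem a c ψ k p) (ha : 0 ≤ a) (hc : 0 ≤ c) (i : Fin 3)
    (j : Fin 4) : loadMatrix a c p i j ≤ ψ 0 + ψ 1 + 1 := by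
  have hcp (i) : 0 ≤ c i * p i := mul_nonneg (hc i) (h.p_nonneg i)
  have hap (i) : 0 ≤ a i * p i / den a p ^ 2 :=
    div_nonneg (mul_nonneg (ha i) (h.p_nonneg i)) (sq_nonneg _)
  have hψ (i) : 0 ≤ ψ i := (hcp i).trans (h.c_mul_le ha i)
  have hweight (i) := (h.weight_le ha i).trans
    (sub_le_self _ (mul_nonneg h.k_nonneg (h.p_nonneg i)))
  have hMN : (a ⬝ᵥ p) ^ 2 / den a p ^ 2 ≤ 1 := by
    rw [← div_pow]
    exact pow_le_one₀ (div_nonneg (dotProduct_nonneg_of_nonneg ha h.p_nonneg)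
      (den_pos ha h.p_nonneg).le) (dotProduct_div_den_le_one ha h.p_nonneg)
  have hinv := inv_den_sq_le_one ha h.p_nonneg
  unfold loadMatrix
  generalize a ⬝ᵥ p = MN at hMN
  fin_cases i <;> fin_cases j <;> simp only [Matrix.of_apply, Matrix.cons_val', Matrix.cons_val,
    Matrix.cons_val_zero, Matrix.cons_val_one, Matrix.cons_val_fin_one, Fin.zero_eta, Fin.mk_one,
    Fin.reduceFinMk, one_div] <;>
    linarith [hcp 0, hcp 1, hap 0, hap 1, hψ 0, hψ 1, hweight 0, hweight 1]

lemma isCompact_setOf_abs_le (m n : Type*) (M : ℝ) :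
    IsCompact {A : Matrix m n ℝ | ∀ i j, |A i j| ≤ M} := by
  change IsCompact {A : m → n → ℝ | ∀ i j, |A i j| ≤ M}
  convert isCompact_Icc (a := fun (_ : m) (_ : n) => -M) (b := fun _ _ => M) using 1
  ext A
  simp [abs_le, Pi.le_def, forall_and]

lemma exists_transpose_mul_inv_mul_le {m n : Type*} [Finite m] [Fintype n] [DecidableEq n]
    {δ : ℝ} (hδ : 0 < δ) (M : ℝ) : ∃ C, ∀ (Q : Matrix n n ℝ) (U : Matrix n m ℝ), δ ≤ Q.det →
      (∀ i j, |Q i j| ≤ M) → (∀ i j, |U i j| ≤ M) → ∀ i j, (U.transpose * Q⁻¹ * U) i j ≤ C := by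
  have hK : IsCompact ({x : Matrix n n ℝ × Matrix n m ℝ | δ ≤ x.1.det} ∩
      {Q | ∀ i j, |Q i j| ≤ M} ×ˢ {U | ∀ i j, |U i j| ≤ M}) :=
    ((isCompact_setOf_abs_le n n M).prod (isCompact_setOf_abs_le n m M)).inter_left
      (isClosed_le continuous_const continuous_fst.matrix_det)
  have hcont (i j) : ContinuousOn
      (fun x : Matrix n n ℝ × Matrix n m ℝ => (x.2.transpose * x.1⁻¹ * x.2) i j)
      ({x | δ ≤ x.1.det} ∩ {Q | ∀ i j, |Q i j| ≤ M} ×ˢ {U | ∀ i j, |U i j| ≤ M}) := by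
    refine fun x hx => ContinuousAt.continuousWithinAt ?_
    have hinv : ContinuousAt (fun x : Matrix n n ℝ × Matrix n m ℝ => x.1⁻¹) x :=
      (continuousAt_matrix_inv _ (by simpa using continuousAt_inv₀ (hδ.trans_le hx.1).ne')).comp
        continuousAt_fst
    have hinv_apply (k l) := continuousAt_pi.1 (continuousAt_pi.1 hinv k) l
    simp only [Matrix.mul_apply, Matrix.transpose_apply]
    fun_prop
  choose C hC using fun i j => hK.bddAbove_image (hcont i j)
  obtain ⟨B, hB⟩ := (Set.finite_range fun ij : m × m => C ij.1 ij.2).bddAbove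
  exact ⟨B, fun Q U hQ hQM hUM i j => (hC i j ⟨(Q, U), ⟨hQ, hQM, hUM⟩, rfl⟩).trans
    (hB ⟨(i, j), rfl⟩)⟩

theorem exists_reducedRisk_le (ψ : Fin 2 → ℝ) (F τ : ℝ) {δ : ℝ} (hδ : 0 < δ) :
    ∃ C, ∀ a c k p, 0 ≤ a → 0 ≤ c → NodeSystem a c ψ k p →
      δ ≤ (nodeLaplacian a c k 0 p).det → reducedRisk a c F τ k 0 p ≤ C := by
  obtain ⟨C, hC⟩ :=
    exists_transpose_mul_inv_mul_le (m := Fin 4) (n := Fin 3) hδ (2 * (ψ 0 + ψ 1) + 1)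
  refine ⟨F ^ 2 * (1 + C + C) + τ ^ 2 * (C + C), fun a c k p ha hc h hdet => ?_⟩
  have hψ (i) : 0 ≤ ψ i := (mul_nonneg (hc i) (h.p_nonneg i)).trans (h.c_mul_le ha i)
  have hL (i j) : loadResponse a c k 0 p i j ≤ C := by
    refine hC _ _ hdet (fun i j => ?_) (fun i j => ?_) i j
    · linarith [h.abs_nodeLaplacian_le ha hc i j]
    · rw [abs_of_nonneg (loadMatrix_nonneg ha hc h.p_nonneg i j)]
      linarith [h.loadMatrix_le ha hc i j, hψ 0, hψ 1]
  have hinv := inv_den_sq_le_one ha h.p_nonneg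
  rw [← one_div] at hinv
  unfold reducedRisk
  gcongr <;> apply hL

lemma NodeSystem.mul_le_det_nodeLaplacian (h : NodeSystem a c ψ k p) (ha : 0 ≤ a) (hc : 0 ≤ c) :
    (k * ∑ i, p i) * (c 0 * p 0 * (c 1 * p 1)) ≤ (nodeLaplacian a c k 0 p).det := by
  have hap (i) : 0 ≤ a i * p i := mul_nonneg (ha i) (h.p_nonneg i)
  have hcp (i) : 0 ≤ c i * p i := mul_nonneg (hc i) (h.p_nonneg i)
  have hk (i) : 0 ≤ k * p i := mul_nonneg h.k_nonneg (h.p_nonneg i)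
  have hle (i) : c i * p i ≤ c i * p i + a i * p i / den a p ^ 2 :=
    le_add_of_nonneg_right (div_nonneg (hap i) (sq_nonneg _))
  have hw (i) := (hcp i).trans (hle i)
  have hv : 0 ≤ a 0 * p 0 * (a 1 * p 1) / den a p ^ 2 :=
    div_nonneg (mul_nonneg (hap 0) (hap 1)) (sq_nonneg _)
  have hprod := mul_le_mul_of_nonneg_left (mul_le_mul (hle 0) (hle 1) (hcp 1) (hw 0))
    (add_nonneg (hk 0) (hk 1))
  rw [nodeLaplacian, det_groundedLaplacian, Fin.sum_univ_two, mul_add]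
  simp only [Pi.smul_apply, smul_eq_mul, mul_zero, zero_mul, add_zero, zero_add]
  linarith [mul_nonneg (mul_nonneg (hk 0) (hk 1)) (add_nonneg (hw 0) (hw 1)),
    mul_nonneg (add_nonneg (hk 0) (hk 1)) (mul_nonneg hv (add_nonneg (hw 0) (hw 1)))]

lemma NodeSystem.det_nodeLaplacian_le (h : NodeSystem a c ψ k p) (ha : 0 ≤ a) (hc : 0 ≤ c)
    (hsum : k * ∑ i, p i = ψ 1) :
    (nodeLaplacian a c k 0 p).det ≤ ψ 1 * (3 * ψ 0 + 2 * ψ 1) * (k * p 0) := by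
  have hap (i) : 0 ≤ a i * p i := mul_nonneg (ha i) (h.p_nonneg i)
  have hk (i) : 0 ≤ k * p i := mul_nonneg h.k_nonneg (h.p_nonneg i)
  have hw_nonneg (i) : 0 ≤ c i * p i + a i * p i / den a p ^ 2 :=
    add_nonneg (mul_nonneg (hc i) (h.p_nonneg i)) (div_nonneg (hap i) (sq_nonneg _))
  rw [Fin.sum_univ_two, mul_add] at hsum
  have hk₀ := hk 0
  have hk₁ := hk 1
  have hψ₁ : 0 ≤ ψ 1 := by linarith
  have hw₀ := hw_nonneg 0
  have hw₁ := hw_nonneg 1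
  have hv : a 0 * p 0 * (a 1 * p 1) / den a p ^ 2 ≤ k * p 0 := by
    linarith [h.coupling_le ha hc]
  have hw₀_le := (h.weight_le ha 0).trans (sub_le_self _ hk₀)
  have hw₁_le : c 1 * p 1 + a 1 * p 1 / den a p ^ 2 ≤ k * p 0 := by linarith [h.weight_le ha 1]
  rw [nodeLaplacian, det_groundedLaplacian]
  simp only [Pi.smul_apply, smul_eq_mul, mul_zero, zero_mul, add_zero, zero_add]
  rw [hsum]
  generalize c 0 * p 0 + a 0 * p 0 / den a p ^ 2 = w₀ at *
  generalize c 1 * p 1 + a 1 * p 1 / den a p ^ 2 = w₁ at *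
  calc _ ≤ k * p 0 * ψ 1 * (ψ 0 + ψ 1) +
          ψ 1 * (k * p 0 * ψ 0 + k * p 0 * ψ 1 + ψ 0 * (k * p 0)) := by
        gcongr <;> linarith
    _ = _ := by ring

lemma NodeSystem.sq_k_mul_le (h : NodeSystem a c ψ k p) (ha : 0 ≤ a) (hc : ∀ i, 0 < c i)
    (hsum : k * ∑ i, p i = ψ 1) : (k * p 0) ^ 2 ≤ (c 1 + a 1) * (ψ 0 / c 0 * ψ 1) := by
  rw [Fin.sum_univ_two, mul_add] at hsum
  have hle : k * p 0 ≤ (c 1 + a 1) * p 1 := by linarith [h.le_mul ha 1]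
  have hkp : 0 ≤ k * p 0 := mul_nonneg h.k_nonneg (h.p_nonneg 0)
  have hca : 0 ≤ c 1 + a 1 := add_nonneg (hc 1).le (ha 1)
  calc (k * p 0) ^ 2 ≤ k * p 0 * ((c 1 + a 1) * p 1) := by
        rw [pow_two]
        gcongr
    _ = (c 1 + a 1) * (p 0 * (k * p 1)) := by ring
    _ ≤ (c 1 + a 1) * (ψ 0 / c 0 * ψ 1) := by
        refine mul_le_mul_of_nonneg_left (mul_le_mul (h.le_div ha hc 0)
          (h.k_mul_le ha (fun i => (hc i).le) 1) (mul_nonneg h.k_nonneg (h.p_nonneg 1))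
          ((h.p_nonneg 0).trans (h.le_div ha hc 0))) hca

lemma NodeSystem.le_det_nodeLaplacian {δ : ℝ} (h : NodeSystem a c ψ k p) (ha : 0 ≤ a)
    (hc : ∀ i, 0 < c i) (ha₁ : a 1 = 0) (hc₁ : c 1 ≤ 1) (hψ : 0 ≤ ψ) (hδ : 0 < δ)
    (hsum : k * ∑ i, p i = ψ 1 - δ) :
    (ψ 1 - δ) * (c 0 * (ψ 0 / (ψ 1 / δ + c 0 + a 0)) * δ) ≤ (nodeLaplacian a c k 0 p).det := by
  have hk (i) : 0 ≤ k * p i := mul_nonneg h.k_nonneg (h.p_nonneg i)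
  have hψ₀ : 0 ≤ ψ 0 := hψ 0
  have hψ₁ : 0 ≤ ψ 1 := hψ 1
  have ha₀ : 0 ≤ a 0 := ha 0
  have hc₀ := hc 0
  have hk₀ := h.k_nonneg
  have hδ_le : δ ≤ c 1 * p 1 := by
    have heq := h.apply_eq 1
    rw [ha₁, zero_mul, zero_div, add_zero] at heq
    rw [Fin.sum_univ_two, mul_add] at hsum
    linarith [hk 0]
  have hk_le : k ≤ ψ 1 / δ := by
    rw [le_div_iff₀ hδ]
    calc k * δ ≤ k * (c 1 * p 1) := by gcongr
      _ = c 1 * (k * p 1) := by ring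
      _ ≤ k * p 1 := mul_le_of_le_one_left (hk 1) hc₁
      _ ≤ ψ 1 := h.k_mul_le ha (fun i => (hc i).le) 1
  have hp_le : ψ 0 / (ψ 1 / δ + c 0 + a 0) ≤ p 0 :=
    (div_le_div_of_nonneg_left hψ₀ (by positivity) (by gcongr)).trans
      ((div_le_iff₀ (by positivity)).2 (h.le_mul ha 0))
  refine le_trans ?_ (h.mul_le_det_nodeLaplacian ha fun i => (hc i).le)
  rw [← hsum]
  have hcp₀ : 0 ≤ c 0 * p 0 := mul_nonneg hc₀.le (h.p_nonneg 0)
  have hsum_nonneg : 0 ≤ k * ∑ i, p i :=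
    mul_nonneg hk₀ (Finset.sum_nonneg fun i _ => h.p_nonneg i)
  gcongr

end ReducedRisk

section SecondThreshold

variable {α : Type*} {l : Filter α} {a c p : α → Fin 2 → ℝ} {k : α → ℝ} {a₀ c₀ ψ : Fin 2 → ℝ}
  {F τ : ℝ}

lemma NodeSystem.tendsto_k_mul_zero (ha : ∀ᶠ x in l, 0 ≤ a x) (hc : ∀ᶠ x in l, ∀ i, 0 < c x i)
    (h : ∀ᶠ x in l, NodeSystem (a x) (c x) ψ (k x) (p x))
    (hsum : ∀ᶠ x in l, k x * ∑ i, p x i = ψ 1) (halim : Tendsto a l (𝓝 a₀))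
    (hclim : Tendsto c l (𝓝 c₀)) (ha₁ : a₀ 1 = 0) (hc₁ : c₀ 1 = 0) (hc₀ : c₀ 0 ≠ 0) :
    Tendsto (fun x => k x * p x 0) l (𝓝 0) := by
  have hbound : Tendsto (fun x => √((c x 1 + a x 1) * (ψ 0 / c x 0 * ψ 1))) l (𝓝 0) := by
    simpa [ha₁, hc₁] using (((tendsto_pi_nhds.1 hclim 1).add (tendsto_pi_nhds.1 halim 1)).mul
      ((tendsto_const_nhds.div (tendsto_pi_nhds.1 hclim 0) hc₀).mul_const (ψ 1))).sqrt
  refine squeeze_zero_norm' ?_ hbound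
  filter_upwards [ha, hc, h, hsum] with x hax hcx hx hsumx
  exact Real.abs_le_sqrt (hx.sq_k_mul_le hax hcx hsumx)

lemma NodeSystem.sub_mul_div_le {a c p : Fin 2 → ℝ} {k : ℝ} (h : NodeSystem a c ψ k p) (ha : 0 ≤ a)
    (hc : ∀ i, 0 < c i) : (ψ 0 - k * p 0) * c 0 / (c 0 + a 0) ≤ c 0 * p 0 := by
  rw [div_le_iff₀ (add_pos_of_pos_of_nonneg (hc 0) (ha 0))]
  have hle : ψ 0 - k * p 0 ≤ p 0 * (c 0 + a 0) := by linarith [h.le_mul ha 0]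
  exact (mul_le_mul_of_nonneg_right hle (hc 0).le).trans_eq (by ring)

lemma NodeSystem.den_le_div {a c p : Fin 2 → ℝ} {k : ℝ} (h : NodeSystem a c ψ k p) (ha : 0 ≤ a)
    (hc : ∀ i, 0 < c i) (hsum : k * ∑ i, p i = ψ 1) (hk : k * p 0 < 1) :
    den a p ≤ (1 + a 0 * (ψ 0 / c 0)) / (1 - k * p 0) := by
  rw [Fin.sum_univ_two, mul_add] at hsum
  have ha₁ : a 1 * p 1 ≤ k * p 0 * den a p := by
    rw [← div_le_iff₀ (den_pos ha h.p_nonneg)]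
    linarith [h.apply_eq 1, mul_nonneg (hc 1).le (h.p_nonneg 1)]
  have ha₀ : a 0 * p 0 ≤ a 0 * (ψ 0 / c 0) := mul_le_mul_of_nonneg_left (h.le_div ha hc 0) (ha 0)
  have hden : den a p = 1 + (a 0 * p 0 + a 1 * p 1) := by rw [den, dotProduct, Fin.sum_univ_two]
  rw [le_div_iff₀ (sub_pos.2 hk)]
  linarith

theorem tendsto_reducedRisk_atTop_of_k_mul_sum_eq (hF : F ≠ 0) (hψ : ∀ i, 0 < ψ i)
    (ha : ∀ᶠ x in l, 0 ≤ a x) (hc : ∀ᶠ x in l, ∀ i, 0 < c x i)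
    (h : ∀ᶠ x in l, NodeSystem (a x) (c x) ψ (k x) (p x))
    (hsum : ∀ᶠ x in l, k x * ∑ i, p x i = ψ 1) (halim : Tendsto a l (𝓝 a₀))
    (hclim : Tendsto c l (𝓝 c₀)) (ha₀ : 0 ≤ a₀ 0) (hc₀ : 0 < c₀ 0) (ha₁ : a₀ 1 = 0)
    (hc₁ : c₀ 1 = 0) : Tendsto (fun x => reducedRisk (a x) (c x) F τ (k x) 0 (p x)) l atTop := by
  have hk := NodeSystem.tendsto_k_mul_zero ha hc h hsum halim hclim ha₁ hc₁ hc₀.ne'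
  have halim₀ := tendsto_pi_nhds.1 halim 0
  have hclim₀ := tendsto_pi_nhds.1 hclim 0
  have hdet_pos : ∀ᶠ x in l, 0 < (nodeLaplacian (a x) (c x) (k x) 0 (p x)).det := by
    filter_upwards [ha, hc, h, hsum] with x hax hcx hx hsumx
    exact hx.det_nodeLaplacian_pos hax hcx hψ le_rfl (by linarith [hψ 1])
  have hcp_bound : Tendsto (fun x => (ψ 0 - k x * p x 0) * c x 0 / (c x 0 + a x 0)) l
      (𝓝 (ψ 0 * c₀ 0 / (c₀ 0 + a₀ 0))) := by
    simpa only [sub_zero, Pi.div_def] using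
      ((hk.const_sub (ψ 0)).mul hclim₀).div (hclim₀.add halim₀)
        (add_pos_of_pos_of_nonneg hc₀ ha₀).ne'
  have hden_bound : Tendsto (fun x => (1 + a x 0 * (ψ 0 / c x 0)) / (1 - k x * p x 0)) l
      (𝓝 (1 + a₀ 0 * (ψ 0 / c₀ 0))) := by
    simpa only [sub_zero, div_one, Pi.div_def] using
      ((halim₀.mul (tendsto_const_nhds.div hclim₀ hc₀.ne')).const_add 1).div (hk.const_sub 1)
        (by norm_num)
  have hm : 0 < ψ 0 * c₀ 0 / (c₀ 0 + a₀ 0) :=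
    div_pos (mul_pos (hψ 0) hc₀) (add_pos_of_pos_of_nonneg hc₀ ha₀)
  refine tendsto_reducedRisk_atTop (M := 1 + a₀ 0 * (ψ 0 / c₀ 0) + 1) hF (hψ 1) (half_pos hm) ha
    (hc.mono fun _ hcx i => (hcx i).le) h (.of_forall fun _ => le_rfl) ?_ ?_ hdet_pos ?_
  · filter_upwards [ha, hc, h, hcp_bound.eventually_const_le (half_lt_self hm)]
      with x hax hcx hx hle
    exact hle.trans (hx.sub_mul_div_le hax hcx)
  · filter_upwards [ha, hc, h, hsum, hk.eventually_lt_const one_pos,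
      hden_bound.eventually_le_const (lt_add_one _)] with x hax hcx hx hsumx hkx hle
    exact (hx.den_le_div hax hcx hsumx hkx).trans hle
  · refine squeeze_zero' (hdet_pos.mono fun _ hx => hx.le) ?_
      (by simpa only [mul_zero] using hk.const_mul (ψ 1 * (3 * ψ 0 + 2 * ψ 1)))
    filter_upwards [ha, hc, h, hsum] with x hax hcx hx hsumx
    exact hx.det_nodeLaplacian_le hax (fun i => (hcx i).le) hsumx

end SecondThreshold

namespace DRFMParams

section Ridge

variable {P : DRFMParams} {F τ lam : ℝ}

/-- The squared linear coefficients `μⱼ₁²` of the two activations. -/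
def linSq (P : DRFMParams) : Fin 2 → ℝ := ![P.μ₁₁ ^ 2, P.μ₂₁ ^ 2]

/-- The squared nonlinear coefficients `μⱼ₂²` of the two activations. -/
def nonlinSq (P : DRFMParams) : Fin 2 → ℝ := ![P.μ₁₂ ^ 2, P.μ₂₂ ^ 2]

/-- The relative widths `ψ₁, ψ₂` of the two feature maps. -/
def widths (P : DRFMParams) : Fin 2 → ℝ := ![P.ψ₁, P.ψ₂]

/-- The variable `k = √λ / |ν₃*|` of `RidgeSystem`. -/
noncomputable def kStar (P : DRFMParams) (lam : ℝ) : ℝ := √lam / (P.nuStar lam 2).im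

/-- The variable `t₃ = √λ |ν₃*|` of `RidgeSystem`. -/
noncomputable def tStar (P : DRFMParams) (lam : ℝ) : ℝ := √lam * (P.nuStar lam 2).im

/-- The variables `pᵢ = -νᵢ* ν₃*` of `RidgeSystem`. -/
noncomputable def pStar (P : DRFMParams) (lam : ℝ) : Fin 2 → ℝ :=
  ![(P.nuStar lam 0).im * (P.nuStar lam 2).im, (P.nuStar lam 1).im * (P.nuStar lam 2).im]

lemma linSq_nonneg (P : DRFMParams) : 0 ≤ P.linSq := by
  intro i
  fin_cases i <;> exact sq_nonneg _

lemma nonlinSq_pos (h₁ : 0 < P.μ₁₂) (h₂ : 0 < P.μ₂₂) (i : Fin 2) : 0 < P.nonlinSq i := by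
  fin_cases i
  exacts [pow_pos h₁ 2, pow_pos h₂ 2]

lemma widths_pos (h₁ : 0 < P.ψ₁) (h₂ : 0 < P.ψ₂) (i : Fin 2) : 0 < P.widths i := by
  fin_cases i
  exacts [h₁, h₂]

lemma sum_widths (P : DRFMParams) : ∑ i, P.widths i = P.ψ₁ + P.ψ₂ := Fin.sum_univ_two _

lemma den_star (P : DRFMParams) (lam : ℝ) : den P.linSq (P.pStar lam) =
    1 + P.μ₁₁ ^ 2 * ((P.nuStar lam 0).im * (P.nuStar lam 2).im) +
      P.μ₂₁ ^ 2 * ((P.nuStar lam 1).im * (P.nuStar lam 2).im) := by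
  simp [den, linSq, pStar, dotProduct, Fin.sum_univ_two, add_assoc]

lemma nuStar_im_pos (h₁ : 0 < P.ψ₁) (h₂ : 0 < P.ψ₂) (h₃ : 0 < P.ψ₃) (hlam : 0 < lam) (j : Fin 3) :
    0 < (P.nuStar lam j).im :=
  (isNu_nu h₁ h₂ h₃).mapsTo _ (sqrt_mul_I_im_pos hlam) j

lemma NuSystem.im_eq {x₀ x₁ x₂ s : ℝ}
    (h : P.NuSystem (s * Complex.I) (x₀ * Complex.I) (x₁ * Complex.I) (x₂ * Complex.I)) :
    x₀ * (s + P.μ₁₂ ^ 2 * x₂ + P.μ₁₁ ^ 2 * x₂ /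
      (1 + P.μ₁₁ ^ 2 * (x₀ * x₂) + P.μ₂₁ ^ 2 * (x₁ * x₂))) = P.ψ₁ ∧
    x₁ * (s + P.μ₂₂ ^ 2 * x₂ + P.μ₂₁ ^ 2 * x₂ /
      (1 + P.μ₁₁ ^ 2 * (x₀ * x₂) + P.μ₂₁ ^ 2 * (x₁ * x₂))) = P.ψ₂ ∧
    x₂ * (s + P.μ₁₂ ^ 2 * x₀ + P.μ₂₂ ^ 2 * x₁ + (P.μ₁₁ ^ 2 * x₀ + P.μ₂₁ ^ 2 * x₁) /
      (1 + P.μ₁₁ ^ 2 * (x₀ * x₂) + P.μ₂₁ ^ 2 * (x₁ * x₂))) = P.ψ₃ := by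
  obtain ⟨eq₁, eq₂, eq₃⟩ := h
  have hden : (1 - (P.μ₁₁ : ℂ) ^ 2 * (x₀ * Complex.I) * (x₂ * Complex.I)
      - (P.μ₂₁ : ℂ) ^ 2 * (x₁ * Complex.I) * (x₂ * Complex.I)) =
      ((1 + P.μ₁₁ ^ 2 * (x₀ * x₂) + P.μ₂₁ ^ 2 * (x₁ * x₂) : ℝ) : ℂ) := by
    push_cast
    linear_combination
      (-(P.μ₂₁ : ℂ) ^ 2 * x₁ * x₂ - (P.μ₁₁ : ℂ) ^ 2 * x₀ * x₂) * Complex.I_mul_I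
  rw [sub_right_comm (1 : ℂ)] at eq₁
  rw [hden] at eq₁ eq₂ eq₃
  generalize 1 + P.μ₁₁ ^ 2 * (x₀ * x₂) + P.μ₂₁ ^ 2 * (x₁ * x₂) = D at *
  refine ⟨Complex.ofReal_injective ?_, Complex.ofReal_injective ?_, Complex.ofReal_injective ?_⟩
  · rw [← eq₁]
    push_cast
    linear_combination (x₀ * (s + P.μ₁₂ ^ 2 * x₂ + P.μ₁₁ ^ 2 * x₂ / D) : ℂ) * Complex.I_mul_I
  · rw [← eq₂]
    push_cast
    linear_combination (x₁ * (s + P.μ₂₂ ^ 2 * x₂ + P.μ₂₁ ^ 2 * x₂ / D) : ℂ) * Complex.I_mul_I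
  · rw [← eq₃]
    push_cast
    linear_combination (x₂ * (s + P.μ₁₂ ^ 2 * x₀ + P.μ₂₂ ^ 2 * x₁ +
      (P.μ₁₁ ^ 2 * x₀ + P.μ₂₁ ^ 2 * x₁) / D) : ℂ) * Complex.I_mul_I

theorem ridgeSystem (h₁ : 0 < P.ψ₁) (h₂ : 0 < P.ψ₂) (h₃ : 0 < P.ψ₃) (hlam : 0 < lam) :
    RidgeSystem P.linSq P.nonlinSq P.widths P.ψ₃ lam (P.kStar lam) (P.tStar lam)
      (P.pStar lam) := by
  have hx := nuStar_im_pos h₁ h₂ h₃ hlam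
  have hsqrt := Real.sqrt_pos.2 hlam
  have hsys := (isNu_nu h₁ h₂ h₃).system _ (sqrt_mul_I_im_pos hlam)
  change P.NuSystem _ (P.nuStar lam 0) (P.nuStar lam 1) (P.nuStar lam 2) at hsys
  rw [nuStar_eq_im_mul_I h₁ h₂ h₃ hlam 0, nuStar_eq_im_mul_I h₁ h₂ h₃ hlam 1,
    nuStar_eq_im_mul_I h₁ h₂ h₃ hlam 2] at hsys
  obtain ⟨eq₁, eq₂, eq₃⟩ := hsys.im_eq
  have hx₀ := hx 0
  have hx₁ := hx 1
  have hx₂ := hx 2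
  refine ⟨⟨(div_pos hsqrt hx₂).le, fun i => ?_, funext fun i => ?_⟩, mul_pos hsqrt hx₂, ?_, ?_⟩
  · fin_cases i
    exacts [(mul_pos hx₀ hx₂).le, (mul_pos hx₁ hx₂).le]
  · rw [nodeMap, den_star]
    fin_cases i <;> simp [kStar, linSq, nonlinSq, pStar, widths, ← eq₁, ← eq₂] <;> field_simp
  · rw [den_star, ← eq₃]
    simp [tStar, linSq, nonlinSq, pStar, dotProduct, Fin.sum_univ_two]
    ring
  · rw [kStar, tStar, div_mul_eq_mul_div, mul_div_assoc, mul_div_assoc, div_self hx₂.ne', mul_one,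
      Real.mul_self_sqrt hlam.le]

end Ridge

end DRFMParams

section MatrixInverse

open Matrix

variable {m n K L : Type*} [Fintype n] [DecidableEq n]

lemma transpose_mul_inv_mul_of_isUnit [CommRing K] {S : Matrix n n K} (hS : IsUnit S)
    (H : Matrix n n K) (V : Matrix n m K) :
    (S * V)ᵀ * (S * H * Sᵀ)⁻¹ * (S * V) = Vᵀ * H⁻¹ * V := by
  have hdet := (Matrix.isUnit_iff_isUnit_det S).1 hS
  have hdetT : IsUnit Sᵀ.det := by rwa [Matrix.det_transpose]
  rw [Matrix.transpose_mul, Matrix.mul_inv_rev, Matrix.mul_inv_rev]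
  simp only [Matrix.mul_assoc, Matrix.mul_nonsing_inv_cancel_left _ _ hdetT,
    Matrix.nonsing_inv_mul_cancel_left _ _ hdet]

lemma inv_map_ringHom [Field K] [Field L] (f : K →+* L) (M : Matrix n n K) :
    (M.map f)⁻¹ = M⁻¹.map f := by
  rw [Matrix.inv_def, Matrix.inv_def, Ring.inverse_eq_inv', Ring.inverse_eq_inv',
    ← RingHom.mapMatrix_apply, ← RingHom.map_det, ← RingHom.map_adjugate, ← map_inv₀]
  ext i j
  simp

end MatrixInverse

namespace DRFMParams

section Bridge

variable {P : DRFMParams} {F τ lam : ℝ}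

lemma nuStar_ne_zero (h₁ : 0 < P.ψ₁) (h₂ : 0 < P.ψ₂) (h₃ : 0 < P.ψ₃) (hlam : 0 < lam) (j : Fin 3) :
    P.nuStar lam j ≠ 0 := fun h0 =>
  (nuStar_im_pos h₁ h₂ h₃ hlam j).ne' (by rw [h0, Complex.zero_im])

lemma ofReal_pStar (h₁ : 0 < P.ψ₁) (h₂ : 0 < P.ψ₂) (h₃ : 0 < P.ψ₃) (hlam : 0 < lam) (i : Fin 2) :
    (P.pStar lam i : ℂ) = -(P.nuStar lam i.castSucc * P.nuStar lam 2) := by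
  rw [nuStar_eq_im_mul_I h₁ h₂ h₃ hlam i.castSucc, nuStar_eq_im_mul_I h₁ h₂ h₃ hlam 2,
    mul_mul_mul_comm, Complex.I_mul_I, mul_neg_one, neg_neg, ← Complex.ofReal_mul]
  fin_cases i <;> rfl

lemma nuStar_two_mul_MN (h₁ : 0 < P.ψ₁) (h₂ : 0 < P.ψ₂) (h₃ : 0 < P.ψ₃) (hlam : 0 < lam) :
    P.nuStar lam 2 * P.MN lam = -((P.linSq ⬝ᵥ P.pStar lam : ℝ) : ℂ) := by
  rw [dotProduct, Fin.sum_univ_two]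
  push_cast
  rw [ofReal_pStar h₁ h₂ h₃ hlam, ofReal_pStar h₁ h₂ h₃ hlam, MN]
  simp [linSq]
  ring

lemma MD_eq_neg_den (h₁ : 0 < P.ψ₁) (h₂ : 0 < P.ψ₂) (h₃ : 0 < P.ψ₃) (hlam : 0 < lam) :
    P.MD lam = -(den P.linSq (P.pStar lam) : ℂ) := by
  rw [MD, nuStar_two_mul_MN h₁ h₂ h₃ hlam, den]
  push_cast
  ring

lemma diagonal_mul_matH_mul_diagonal (h₁ : 0 < P.ψ₁) (h₂ : 0 < P.ψ₂) (h₃ : 0 < P.ψ₃)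
    (hlam : 0 < lam) :
    Matrix.diagonal ![P.nuStar lam 0, P.nuStar lam 1, -P.nuStar lam 2] * P.matH lam *
        (Matrix.diagonal ![P.nuStar lam 0, P.nuStar lam 1, -P.nuStar lam 2]).transpose =
      (nodeLaplacian P.linSq P.nonlinSq (P.kStar lam) (P.tStar lam) (P.pStar lam)).map
        Complex.ofRealHom := by
  have hn := nuStar_ne_zero h₁ h₂ h₃ hlam
  have hn₀ := hn 0
  have hn₁ := hn 1
  have hn₂ := hn 2
  have hsys := ridgeSystem h₁ h₂ h₃ hlam
  have hD : (den P.linSq (P.pStar lam) : ℂ) ≠ 0 :=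
    Complex.ofReal_ne_zero.2 (den_pos P.linSq_nonneg hsys.p_nonneg).ne'
  have hMN := nuStar_two_mul_MN h₁ h₂ h₃ hlam
  have hMD := MD_eq_neg_den h₁ h₂ h₃ hlam
  have hp₀ : (P.pStar lam 0 : ℂ) = _ := ofReal_pStar h₁ h₂ h₃ hlam 0
  have hp₁ : (P.pStar lam 1 : ℂ) = _ := ofReal_pStar h₁ h₂ h₃ hlam 1
  rw [hsys.nodeLaplacian_eq P.linSq_nonneg, Matrix.diagonal_transpose]
  generalize den P.linSq (P.pStar lam) = D at hD hMD ⊢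
  generalize P.linSq ⬝ᵥ P.pStar lam = A at hMN ⊢
  ext i j
  rw [Matrix.mul_diagonal, Matrix.diagonal_mul, Matrix.map_apply]
  fin_cases i <;> fin_cases j <;>
    simp [matH, hMD, hp₀, hp₁, linSq, nonlinSq, widths] <;>
    field_simp <;> try ring1
  linear_combination (A - P.nuStar lam 2 * P.MN lam) * hMN

lemma diagonal_mul_matV (h₁ : 0 < P.ψ₁) (h₂ : 0 < P.ψ₂) (h₃ : 0 < P.ψ₃) (hlam : 0 < lam) :
    Matrix.diagonal ![P.nuStar lam 0, P.nuStar lam 1, -P.nuStar lam 2] * P.matV lam =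
      (loadMatrix P.linSq P.nonlinSq (P.pStar lam)).map Complex.ofRealHom *
        Matrix.diagonal ![-(P.nuStar lam 2)⁻¹, -P.nuStar lam 2, -(P.nuStar lam 2)⁻¹,
          -P.nuStar lam 2] := by
  have hn₂ := nuStar_ne_zero h₁ h₂ h₃ hlam 2
  have hD : (den P.linSq (P.pStar lam) : ℂ) ≠ 0 := Complex.ofReal_ne_zero.2
    (den_pos P.linSq_nonneg (ridgeSystem h₁ h₂ h₃ hlam).p_nonneg).ne'
  have hMN := nuStar_two_mul_MN h₁ h₂ h₃ hlam
  have hMD := MD_eq_neg_den h₁ h₂ h₃ hlam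
  have hp₀ : (P.pStar lam 0 : ℂ) = _ := ofReal_pStar h₁ h₂ h₃ hlam 0
  have hp₁ : (P.pStar lam 1 : ℂ) = _ := ofReal_pStar h₁ h₂ h₃ hlam 1
  unfold loadMatrix
  generalize den P.linSq (P.pStar lam) = D at hD hMD ⊢
  generalize P.linSq ⬝ᵥ P.pStar lam = A at hMN ⊢
  ext i j
  rw [Matrix.mul_diagonal, Matrix.diagonal_mul, Matrix.map_apply]
  fin_cases i <;> fin_cases j <;> simp [matV, hMD, hp₀, hp₁, linSq, nonlinSq] <;>
    field_simp
  linear_combination (P.nuStar lam 2 * P.MN lam - A) * hMN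

lemma matL_apply (h₁ : 0 < P.ψ₁) (h₂ : 0 < P.ψ₂) (h₃ : 0 < P.ψ₃) (hlam : 0 < lam) (i j : Fin 4) :
    P.matL lam i j =
      ![-(P.nuStar lam 2)⁻¹, -P.nuStar lam 2, -(P.nuStar lam 2)⁻¹, -P.nuStar lam 2] i *
        loadResponse P.linSq P.nonlinSq (P.kStar lam) (P.tStar lam) (P.pStar lam) i j *
        ![-(P.nuStar lam 2)⁻¹, -P.nuStar lam 2, -(P.nuStar lam 2)⁻¹, -P.nuStar lam 2] j := by
  have hunit : IsUnit (Matrix.diagonal ![P.nuStar lam 0, P.nuStar lam 1, -P.nuStar lam 2]) := by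
    have hn := nuStar_ne_zero h₁ h₂ h₃ hlam
    simp [Matrix.isUnit_iff_isUnit_det, Matrix.det_diagonal, Fin.prod_univ_three, hn]
  rw [matL, ← transpose_mul_inv_mul_of_isUnit hunit, diagonal_mul_matV h₁ h₂ h₃ hlam,
    diagonal_mul_matH_mul_diagonal h₁ h₂ h₃ hlam, inv_map_ringHom, Matrix.transpose_mul,
    Matrix.diagonal_transpose, ← Matrix.transpose_map,
    ← Matrix.mul_assoc, Matrix.mul_diagonal, Matrix.mul_assoc, Matrix.mul_assoc,
    Matrix.diagonal_mul, ← Matrix.map_mul, ← Matrix.map_mul, ← Matrix.mul_assoc]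
  rfl

theorem risk_eq_reducedRisk (h₁ : 0 < P.ψ₁) (h₂ : 0 < P.ψ₂) (h₃ : 0 < P.ψ₃) (hlam : 0 < lam) :
    P.risk F τ lam =
      reducedRisk P.linSq P.nonlinSq F τ (P.kStar lam) (P.tStar lam) (P.pStar lam) := by
  have hn₂ := nuStar_ne_zero h₁ h₂ h₃ hlam 2
  rw [risk, ← Complex.ofReal_re (reducedRisk ..), reducedRisk, MD_eq_neg_den h₁ h₂ h₃ hlam]
  simp only [matL_apply h₁ h₂ h₃ hlam]
  congr 1
  simp
  field_simp

end Bridge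

section RidgelessLimit

variable {P : DRFMParams} {F τ : ℝ}

lemma eventually_ridgeSystem (h₁ : 0 < P.ψ₁) (h₂ : 0 < P.ψ₂) (h₃ : 0 < P.ψ₃) :
    ∀ᶠ lam in 𝓝[>] 0, RidgeSystem P.linSq P.nonlinSq P.widths P.ψ₃ lam (P.kStar lam)
      (P.tStar lam) (P.pStar lam) :=
  eventually_mem_nhdsWithin.mono fun _ hlam => ridgeSystem h₁ h₂ h₃ hlam

lemma risk_eventuallyEq (h₁ : 0 < P.ψ₁) (h₂ : 0 < P.ψ₂) (h₃ : 0 < P.ψ₃) :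
    P.risk F τ =ᶠ[𝓝[>] 0] fun lam =>
      reducedRisk P.linSq P.nonlinSq F τ (P.kStar lam) (P.tStar lam) (P.pStar lam) :=
  eventually_mem_nhdsWithin.mono fun _ hlam => risk_eq_reducedRisk h₁ h₂ h₃ hlam

theorem exists_tendsto_star (h₁ : 0 < P.ψ₁) (h₂ : 0 < P.ψ₂) (h₃ : 0 < P.ψ₃) (hμ₁ : 0 < P.μ₁₂)
    (hμ₂ : 0 < P.μ₂₂) : ∃ k p, NodeSystem P.linSq P.nonlinSq P.widths k p ∧
      k * ∑ i, p i = max (P.ψ₁ + P.ψ₂ - P.ψ₃) 0 ∧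
      Tendsto (fun lam => (P.kStar lam, P.tStar lam, P.pStar lam)) (𝓝[>] 0)
        (𝓝 (k, max (P.ψ₃ - (P.ψ₁ + P.ψ₂)) 0, p)) := by
  have hlam : Tendsto (fun lam : ℝ => lam) (𝓝[>] 0) (𝓝 0) := nhdsWithin_le_nhds
  have hsys := eventually_ridgeSystem h₁ h₂ h₃
  have ht := RidgeSystem.tendsto_t₃ P.linSq_nonneg (nonlinSq_pos hμ₁ hμ₂) hlam hsys
  obtain ⟨k, p, hnode, hsum, hk, hp⟩ := RidgeSystem.exists_tendsto P.linSq_nonneg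
    (nonlinSq_pos hμ₁ hμ₂) (widths_pos h₁ h₂) h₃ hlam hsys
  rw [sum_widths] at ht hsum
  exact ⟨k, p, hnode, hsum, hk.prodMk_nhds (ht.prodMk_nhds hp)⟩

theorem exists_tendsto_risk_of_ne (h₁ : 0 < P.ψ₁) (h₂ : 0 < P.ψ₂) (h₃ : 0 < P.ψ₃)
    (hμ₁ : 0 < P.μ₁₂) (hμ₂ : 0 < P.μ₂₂) (hne : P.ψ₁ + P.ψ₂ ≠ P.ψ₃) (F τ : ℝ) :
    ∃ k p, NodeSystem P.linSq P.nonlinSq P.widths k p ∧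
      k * ∑ i, p i = max (P.ψ₁ + P.ψ₂ - P.ψ₃) 0 ∧
      Tendsto (P.risk F τ) (𝓝[>] 0)
        (𝓝 (reducedRisk P.linSq P.nonlinSq F τ k (max (P.ψ₃ - (P.ψ₁ + P.ψ₂)) 0) p)) := by
  obtain ⟨k, p, hnode, hsum, hlim⟩ := exists_tendsto_star h₁ h₂ h₃ hμ₁ hμ₂
  refine ⟨k, p, hnode, hsum, Tendsto.congr' (risk_eventuallyEq h₁ h₂ h₃).symm ?_⟩
  have hpos : 0 < k * ∑ i, p i + max (P.ψ₃ - (P.ψ₁ + P.ψ₂)) 0 := by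
    rw [hsum]
    rcases hne.lt_or_gt with hlt | hgt
    · exact add_pos_of_nonneg_of_pos (le_max_right _ _) (lt_max_of_lt_left (sub_pos.2 hlt))
    · exact add_pos_of_pos_of_nonneg (lt_max_of_lt_left (sub_pos.2 hgt)) (le_max_right _ _)
  have hdet := hnode.det_nodeLaplacian_pos P.linSq_nonneg (nonlinSq_pos hμ₁ hμ₂)
    (widths_pos h₁ h₂) (le_max_right _ _) hpos
  have hcont : ContinuousAt (fun u : ℝ × ℝ × (Fin 2 → ℝ) =>
      reducedRisk P.linSq P.nonlinSq F τ u.1 u.2.1 u.2.2) (k, max (P.ψ₃ - (P.ψ₁ + P.ψ₂)) 0, p) :=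
    continuousAt_reducedRisk (den_pos P.linSq_nonneg hnode.p_nonneg).ne' hdet.ne'
  simpa only [Function.comp_def] using hcont.tendsto.comp hlim

theorem tendsto_risk_atTop_of_eq (h₁ : 0 < P.ψ₁) (h₂ : 0 < P.ψ₂) (h₃ : 0 < P.ψ₃)
    (hμ₁ : 0 < P.μ₁₂) (hμ₂ : 0 < P.μ₂₂) (hF : F ≠ 0) (heq : P.ψ₁ + P.ψ₂ = P.ψ₃) :
    Tendsto (P.risk F τ) (𝓝[>] 0) atTop := by
  have hψ := widths_pos h₁ h₂
  have hc := nonlinSq_pos hμ₁ hμ₂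
  have hsys := eventually_ridgeSystem h₁ h₂ h₃
  obtain ⟨k, p, hnode, hsum, hlim⟩ := exists_tendsto_star h₁ h₂ h₃ hμ₁ hμ₂
  rw [heq, sub_self, max_self] at hsum hlim
  have hD : den P.linSq p ≠ 0 := (den_pos P.linSq_nonneg hnode.p_nonneg).ne'
  have hcp : 0 < P.nonlinSq 0 * p 0 := mul_pos (hc 0) (hnode.p_pos P.linSq_nonneg (hψ 0))
  have hplim : Tendsto P.pStar (𝓝[>] 0) (𝓝 p) := hlim.snd_nhds.snd_nhds
  have hcplim := (tendsto_pi_nhds.1 hplim 0).const_mul (P.nonlinSq 0)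
  have hdenlim := ((continuous_den P.linSq).tendsto p).comp hplim
  refine Tendsto.congr' (risk_eventuallyEq h₁ h₂ h₃).symm
    (tendsto_reducedRisk_atTop hF (hψ 1) (half_pos hcp) (.of_forall fun _ => P.linSq_nonneg)
      (.of_forall fun _ i => (hc i).le) (hsys.mono fun _ h => h.toNodeSystem)
      (hsys.mono fun _ h => h.t₃_pos.le) (hcplim.eventually (Ici_mem_nhds (half_lt_self hcp)))
      (hdenlim.eventually (Iic_mem_nhds (lt_add_one _))) (hsys.mono fun lam h => ?_) ?_)
  · exact h.det_nodeLaplacian_pos P.linSq_nonneg hc hψ h.t₃_pos.le (add_pos_of_nonneg_of_pos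
      (mul_nonneg h.k_nonneg (Finset.sum_nonneg fun i _ => h.p_nonneg i)) h.t₃_pos)
  · have hk : k = 0 := by
      refine (mul_eq_zero.1 hsum).resolve_right (Finset.sum_pos (fun i _ => ?_) ?_).ne'
      exacts [hnode.p_pos P.linSq_nonneg (hψ i), Finset.univ_nonempty]
    subst hk
    have hcont : ContinuousAt (fun u : ℝ × ℝ × (Fin 2 → ℝ) =>
        (nodeLaplacian P.linSq P.nonlinSq u.1 u.2.1 u.2.2).det) (0, 0, p) :=
      (Continuous.matrix_det continuous_id).continuousAt.comp (continuousAt_nodeLaplacian hD)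
    simpa only [Function.comp_def, det_nodeLaplacian_zero_zero] using hcont.tendsto.comp hlim

end RidgelessLimit

section RidgelessRisk

variable {P : DRFMParams}

/-- The ridgeless limit `λ → 0⁺` of the excess risk. It is meaningful away from the interpolation
threshold `ψ₁ + ψ₂ = ψ₃`, see `tendsto_ridgelessRisk`. -/
noncomputable def ridgelessRisk (P : DRFMParams) (F τ : ℝ) : ℝ := limUnder (𝓝[>] 0) (P.risk F τ)

theorem tendsto_ridgelessRisk (h₁ : 0 < P.ψ₁) (h₂ : 0 < P.ψ₂) (h₃ : 0 < P.ψ₃)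
    (hμ₁ : 0 < P.μ₁₂) (hμ₂ : 0 < P.μ₂₂) (hne : P.ψ₁ + P.ψ₂ ≠ P.ψ₃) (F τ : ℝ) :
    Tendsto (P.risk F τ) (𝓝[>] 0) (𝓝 (P.ridgelessRisk F τ)) := by
  obtain ⟨k, p, -, -, hlim⟩ := exists_tendsto_risk_of_ne h₁ h₂ h₃ hμ₁ hμ₂ hne F τ
  exact tendsto_nhds_limUnder ⟨_, hlim⟩

theorem exists_ridgelessRisk_eq (h₁ : 0 < P.ψ₁) (h₂ : 0 < P.ψ₂) (h₃ : 0 < P.ψ₃)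
    (hμ₁ : 0 < P.μ₁₂) (hμ₂ : 0 < P.μ₂₂) (hlt : P.ψ₃ < P.ψ₁ + P.ψ₂) (F τ : ℝ) :
    ∃ k p, NodeSystem P.linSq P.nonlinSq P.widths k p ∧ k * ∑ i, p i = P.ψ₁ + P.ψ₂ - P.ψ₃ ∧
      P.ridgelessRisk F τ = reducedRisk P.linSq P.nonlinSq F τ k 0 p := by
  obtain ⟨k, p, hnode, hsum, hlim⟩ := exists_tendsto_risk_of_ne h₁ h₂ h₃ hμ₁ hμ₂ hlt.ne' F τ
  rw [max_eq_left (sub_nonneg.2 hlt.le)] at hsum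
  rw [max_eq_right (sub_nonpos.2 hlt.le)] at hlim
  exact ⟨k, p, hnode, hsum, hlim.limUnder_eq⟩

end RidgelessRisk

section VanishingSecondFeature

variable {ψ₁ ψ₂ ψ₃ μ₁₁ μ₁₂ : ℝ}

theorem exists_ridgelessRisk_le (h₁ : 0 < ψ₁) (h₂ : 0 < ψ₂) (hμ : 0 < μ₁₂) (h₁₃ : ψ₁ < ψ₃)
    (hlt : ψ₃ < ψ₁ + ψ₂) (F τ : ℝ) : ∃ C, ∀ μ₂₂, 0 < μ₂₂ → μ₂₂ ≤ 1 →
      (DRFMParams.mk ψ₁ ψ₂ ψ₃ μ₁₁ μ₁₂ 0 μ₂₂).ridgelessRisk F τ ≤ C := by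
  have hδ : 0 < ψ₃ - ψ₁ := sub_pos.2 h₁₃
  have hdet : 0 < (ψ₂ - (ψ₃ - ψ₁)) * (μ₁₂ ^ 2 *
      (ψ₁ / (ψ₂ / (ψ₃ - ψ₁) + μ₁₂ ^ 2 + μ₁₁ ^ 2)) * (ψ₃ - ψ₁)) :=
    mul_pos (by linarith) (by positivity)
  obtain ⟨C, hC⟩ := exists_reducedRisk_le ![ψ₁, ψ₂] F τ hdet
  refine ⟨C, fun μ₂₂ hμ₂ hle => ?_⟩
  set P := DRFMParams.mk ψ₁ ψ₂ ψ₃ μ₁₁ μ₁₂ 0 μ₂₂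
  have hc := nonlinSq_pos (P := P) hμ hμ₂
  have hψ := widths_pos (P := P) h₁ h₂
  obtain ⟨k, p, hnode, hsum, heq⟩ :=
    exists_ridgelessRisk_eq (P := P) h₁ h₂ (h₁.trans h₁₃) hμ hμ₂ hlt F τ
  rw [heq]
  refine hC _ _ k p P.linSq_nonneg (fun i => (hc i).le) hnode ?_
  exact hnode.le_det_nodeLaplacian P.linSq_nonneg hc (zero_pow two_ne_zero)
    (pow_le_one₀ hμ₂.le hle) (fun i => (hψ i).le) hδ
    (hsum.trans (show ψ₁ + ψ₂ - ψ₃ = ψ₂ - (ψ₃ - ψ₁) by ring))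

theorem liminf_ridgelessRisk_lt_top (h₁ : 0 < ψ₁) (h₂ : 0 < ψ₂) (hμ : 0 < μ₁₂) (h₁₃ : ψ₁ < ψ₃)
    (hlt : ψ₃ < ψ₁ + ψ₂) (F τ : ℝ) :
    liminf (fun m : ℝ × ℝ =>
      ((DRFMParams.mk ψ₁ ψ₂ ψ₃ μ₁₁ μ₁₂ m.1 m.2).ridgelessRisk F τ : EReal))
      (𝓝 0 ×ˢ 𝓝[>] 0) < ⊤ := by
  obtain ⟨C, hC⟩ := exists_ridgelessRisk_le (μ₁₁ := μ₁₁) h₁ h₂ hμ h₁₃ hlt F τ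
  refine (liminf_le_of_frequently_le' ?_).trans_lt (EReal.coe_lt_top C)
  have haxis : Tendsto (fun μ₂₂ : ℝ => ((0 : ℝ), μ₂₂)) (𝓝[>] 0) (𝓝 0 ×ˢ 𝓝[>] 0) :=
    tendsto_const_nhds.prodMk tendsto_id
  refine haxis.frequently (Eventually.frequently ?_)
  filter_upwards [Ioc_mem_nhdsGT one_pos] with μ₂₂ hμ₂
  exact EReal.coe_le_coe_iff.2 (hC μ₂₂ hμ₂.1 hμ₂.2)

theorem tendsto_ridgelessRisk_atTop (h₁ : 0 < ψ₁) (h₂ : 0 < ψ₂) (hμ : 0 < μ₁₂) {F : ℝ}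
    (hF : F ≠ 0) (τ : ℝ) :
    Tendsto (fun m : ℝ × ℝ => (DRFMParams.mk ψ₁ ψ₂ ψ₁ μ₁₁ μ₁₂ m.1 m.2).ridgelessRisk F τ)
      (𝓝 0 ×ˢ 𝓝[>] 0) atTop := by
  have hμ₂ : ∀ᶠ m : ℝ × ℝ in 𝓝 0 ×ˢ 𝓝[>] 0, 0 < m.2 :=
    tendsto_snd.eventually self_mem_nhdsWithin
  have hfst : Tendsto (fun m : ℝ × ℝ => m.1 ^ 2) (𝓝 0 ×ˢ 𝓝[>] 0) (𝓝 0) := by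
    simpa using (tendsto_fst (f := 𝓝 (0 : ℝ)) (g := 𝓝[>] (0 : ℝ))).pow 2
  have hsnd : Tendsto (fun m : ℝ × ℝ => m.2 ^ 2) (𝓝 0 ×ˢ 𝓝[>] 0) (𝓝 0) := by
    simpa using ((tendsto_snd (f := 𝓝 (0 : ℝ)) (g := 𝓝[>] (0 : ℝ))).mono_right
      nhdsWithin_le_nhds).pow 2
  choose! k p hnode hsum heq using fun (m : ℝ × ℝ) (hm : 0 < m.2) =>
    exists_ridgelessRisk_eq (P := DRFMParams.mk ψ₁ ψ₂ ψ₁ μ₁₁ μ₁₂ m.1 m.2) h₁ h₂ h₁ hμ hm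
      (lt_add_of_pos_right ψ₁ h₂) F τ
  refine Tendsto.congr' (hμ₂.mono fun m hm => (heq m hm).symm) ?_
  refine tendsto_reducedRisk_atTop_of_k_mul_sum_eq (ψ := ![ψ₁, ψ₂]) (a₀ := ![μ₁₁ ^ 2, 0])
    (c₀ := ![μ₁₂ ^ 2, 0]) hF (Fin.forall_fin_two.2 ⟨h₁, h₂⟩) (.of_forall fun m => linSq_nonneg _)
    (hμ₂.mono fun m hm => nonlinSq_pos hμ hm) (hμ₂.mono hnode)
    (hμ₂.mono fun m hm => (hsum m hm).trans (add_sub_cancel_left ..))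
    (tendsto_pi_nhds.2 (Fin.forall_fin_two.2 ⟨tendsto_const_nhds, hfst⟩))
    (tendsto_pi_nhds.2 (Fin.forall_fin_two.2 ⟨tendsto_const_nhds, hsnd⟩))
    (sq_nonneg μ₁₁) (pow_pos hμ 2) rfl rfl

end VanishingSecondFeature

end DRFMParams

open DRFMParams

theorem proposition1 (ψ₁ ψ₂ ψ₃ : ℝ) (hψ₁ : 0 < ψ₁) (hψ₂ : 0 < ψ₂) (hψ₃ : 0 < ψ₃)
    (μ₁₁ μ₁₂ : ℝ) (hμ₁₂ : 0 < μ₁₂) (F₁ τ : ℝ) (hF₁ : 0 < F₁) :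
    -- below the interpolation threshold: finite ridgeless limit
    ((ψ₁ + ψ₂) / ψ₃ < 1 →
      ∀ μ₂₁ μ₂₂ : ℝ, 0 < μ₂₂ →
        ∃ l : ℝ, Tendsto
          (fun lam : ℝ => (DRFMParams.mk ψ₁ ψ₂ ψ₃ μ₁₁ μ₁₂ μ₂₁ μ₂₂).risk F₁ τ lam)
          (𝓝[>] 0) (𝓝 l)) ∧
    -- at the interpolation threshold: infinite ridgeless limit
    ((ψ₁ + ψ₂) / ψ₃ = 1 →
      ∀ μ₂₁ μ₂₂ : ℝ, 0 < μ₂₂ →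
        Tendsto
          (fun lam : ℝ => (DRFMParams.mk ψ₁ ψ₂ ψ₃ μ₁₁ μ₁₂ μ₂₁ μ₂₂).risk F₁ τ lam)
          (𝓝[>] 0) atTop) ∧
    -- between the two thresholds: the lower limit of the ridgeless risk is finite
    (1 < (ψ₁ + ψ₂) / ψ₃ → (ψ₁ + ψ₂) / ψ₃ < 1 + ψ₂ / ψ₁ →
      ∃ R₀ : ℝ → ℝ → ℝ,
        (∀ μ₂₁ μ₂₂ : ℝ, 0 < μ₂₂ →
          Tendsto
            (fun lam : ℝ => (DRFMParams.mk ψ₁ ψ₂ ψ₃ μ₁₁ μ₁₂ μ₂₁ μ₂₂).risk F₁ τ lam)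
            (𝓝[>] 0) (𝓝 (R₀ μ₂₁ μ₂₂))) ∧
        liminf (fun m : ℝ × ℝ => ((R₀ m.1 m.2 : ℝ) : EReal)) (𝓝 0 ×ˢ 𝓝[>] 0) < ⊤) ∧
    -- at the second threshold: the ridgeless risk diverges
    ((ψ₁ + ψ₂) / ψ₃ = 1 + ψ₂ / ψ₁ →
      ∃ R₀ : ℝ → ℝ → ℝ,
        (∀ μ₂₁ μ₂₂ : ℝ, 0 < μ₂₂ →
          Tendsto
            (fun lam : ℝ => (DRFMParams.mk ψ₁ ψ₂ ψ₃ μ₁₁ μ₁₂ μ₂₁ μ₂₂).risk F₁ τ lam)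
            (𝓝[>] 0) (𝓝 (R₀ μ₂₁ μ₂₂))) ∧
        Tendsto (fun m : ℝ × ℝ => R₀ m.1 m.2) (𝓝 0 ×ˢ 𝓝[>] 0) atTop) := by
  have hratio : 1 + ψ₂ / ψ₁ = (ψ₁ + ψ₂) / ψ₁ := by field_simp
  have hlim (hne : ψ₁ + ψ₂ ≠ ψ₃) (μ₂₁ μ₂₂ : ℝ) (hμ₂₂ : 0 < μ₂₂) :=
    tendsto_ridgelessRisk (P := DRFMParams.mk ψ₁ ψ₂ ψ₃ μ₁₁ μ₁₂ μ₂₁ μ₂₂) hψ₁ hψ₂ hψ₃ hμ₁₂ hμ₂₂ hne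
      F₁ τ
  refine ⟨fun h μ₂₁ μ₂₂ hμ₂₂ => ?_, fun h μ₂₁ μ₂₂ hμ₂₂ => ?_, fun hgt hlt => ?_, fun h => ?_⟩
  · exact ⟨_, hlim ((div_lt_one hψ₃).1 h).ne μ₂₁ μ₂₂ hμ₂₂⟩
  · exact tendsto_risk_atTop_of_eq hψ₁ hψ₂ hψ₃ hμ₁₂ hμ₂₂ hF₁.ne' ((div_eq_one_iff_eq hψ₃.ne').1 h)
  · rw [one_lt_div hψ₃] at hgt
    rw [hratio, div_lt_div_iff_of_pos_left (by positivity) hψ₃ hψ₁] at hlt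
    exact ⟨_, hlim hgt.ne', liminf_ridgelessRisk_lt_top hψ₁ hψ₂ hμ₁₂ hlt hgt F₁ τ⟩
  · obtain rfl : ψ₃ = ψ₁ := by
      rw [hratio, div_eq_div_iff hψ₃.ne' hψ₁.ne'] at h
      exact (mul_left_cancel₀ (by positivity) h).symm
    exact ⟨_, hlim (lt_add_of_pos_right ψ₃ hψ₂).ne',
      tendsto_ridgelessRisk_atTop hψ₁ hψ₂ hμ₁₂ hF₁.ne' τ⟩
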